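/- Let $2\le n\le\infty$ (where $n=\infty$ means countably many generators), let $\mathbb F_n$ be the free group on $n$ generators, and let $a$ be one of these generators. Let $\mathcal M=VN(\mathbb F_n)$ be the von Neumann algebra on $\ell^2(\mathbb F_n)$ generated by the left regular representation $\lambda$, with its normalized trace $\mathrm{tr}(x)=\langle x\delta_e,\delta_e\rangle$ and the norm $\|x\|_2=\mathrm{tr}(x^*x)^{1/2}$, and let $\mathcal A\subseteq\mathcal M$ be the von Neumann subalgebra generated by $\lambda(a)$. For a von Neumann subalgebra $\mathcal N\subseteq\mathcal M$ let $\mathbb E_{\mathcal N}:\mathcal M\to\mathcal N$ be the unique trace preserving conditional expectation, and for a linear map $\phi:\mathcal M\to\mathcal M$ put $\|\phi\|_{\infty,2}=\sup\{\|\phi(x)\|_2: x\in\mathcal M,\ \|x\|\le 1\}$. Then: 1. $\mathcal A$ is a masa (a maximal abelian self-adjoint subalgebra) in $\mathcal M$. 2. $\mathcal A$ is strongly singular: for every unitary $u\in\mathcal M$, $$\|\mathbb E_{u\mathcal Au^*}-\mathbb E_{\mathcal A}\|_{\infty,2}\ \ge\ \|u-\mathbb E_{\mathcal A}(u)\|_2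 .$$ 3. The Popa invariant $\delta(\mathcal A)$ equals $1$. Here $\delta(\mathcal A)$ is the largest $c\in\mathbb R$ such that $\delta(v\mathcal Av^*,\mathcal A)\ge c\|v^*v\|_2$ for all nonzero partial isometries $v\in\mathcal M$ for which $vv^*$ and $v^*v$ are orthogonal projections in $\mathcal A$, where $$\delta(v\mathcal Av^*,\mathcal A)=\sup\{\|x-\mathbb E_{\mathcal A}(x)\|_2:\ x\in v\mathcal Av^*,\ \|x\|\le 1\}.$$ -/

import Mathlib

/-! ## Masas in a star algebra with a trace

In this part `M` is meant to be a finite von Neumann algebra (a `II₁` factor) with its operator norm,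
`τ` its normalized trace, and star subalgebras are unital. -/

section Abstract

variable {M : Type*} [NormedRing M] [StarRing M] [NormedAlgebra ℂ M] [StarModule ℂ M]

/-- `A` is a maximal abelian self-adjoint subalgebra of `M`. -/
def IsMasa (A : StarSubalgebra ℂ M) : Prop :=
  Maximal (fun B : StarSubalgebra ℂ M => ∀ x ∈ B, ∀ y ∈ B, x * y = y * x) A

/-- The trace norm `‖x‖₂ = τ(x*x)^{1/2}`. -/
noncomputable def twoNorm (τ : M →ₗ[ℂ] ℂ) (x : M) : ℝ :=
  Real.sqrt (τ (star x * x)).re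

/-- The norm `‖φ‖_{∞,2}` of a linear map `φ : M → M`, where the domain carries the operator norm and
the range carries the trace norm. -/
noncomputable def inftyTwoNorm (τ : M →ₗ[ℂ] ℂ) (φ : M →ₗ[ℂ] M) : ℝ :=
  sSup {r : ℝ | ∃ x : M, ‖x‖ ≤ 1 ∧ r = twoNorm τ (φ x)}

/-- `E` is a trace preserving conditional expectation of `M` onto `N`: a contractive linear
projection onto `N` which is an `N`-bimodule map and preserves the trace. -/
structure IsCondExp (τ : M →ₗ[ℂ] ℂ) (N : StarSubalgebra ℂ M) (E : M →ₗ[ℂ] M) : Prop where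
  mem : ∀ x, E x ∈ N
  apply_of_mem : ∀ y ∈ N, E y = y
  bimodule : ∀ y ∈ N, ∀ z ∈ N, ∀ x, E (y * x * z) = y * E x * z
  norm_le : ∀ x, ‖E x‖ ≤ ‖x‖
  trace_apply : ∀ x, τ (E x) = τ x

open Classical in
/-- The trace preserving conditional expectation `E_N` of `M` onto `N`. (If `M` is a von Neumann
algebra, `τ` a faithful normal trace, and `N` a von Neumann subalgebra, then it exists and is unique,
so that the default value `0` does not occur.) -/
noncomputable def condExp (τ : M →ₗ[ℂ] ℂ) (N : StarSubalgebra ℂ M) : M →ₗ[ℂ] M :=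
  if h : ∃ E, IsCondExp τ N E then h.choose else 0

/-- The unitary conjugate `u A u*`. -/
noncomputable def unitaryConj (u : unitary M) (A : StarSubalgebra ℂ M) : StarSubalgebra ℂ M :=
  A.map (Unitary.conjStarAlgAut ℂ M u : M →⋆ₐ[ℂ] M)

/-- `A` is `α`-strongly singular: `‖E_{uAu*} - E_A‖_{∞,2} ≥ α ‖u - E_A(u)‖₂` for all unitaries
`u ∈ M`. -/
def IsAlphaStronglySingular (τ : M →ₗ[ℂ] ℂ) (α : ℝ) (A : StarSubalgebra ℂ M) : Prop :=
  ∀ u : unitary M,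
    α * twoNorm τ ((u : M) - condExp τ A (u : M)) ≤
      inftyTwoNorm τ (condExp τ (unitaryConj u A) - condExp τ A)

/-- `A` is strongly singular. -/
def IsStronglySingular (τ : M →ₗ[ℂ] ℂ) (A : StarSubalgebra ℂ M) : Prop :=
  IsAlphaStronglySingular τ 1 A

/-- `v` is a nonzero partial isometry in `M` such that `v v*` and `v* v` are orthogonal projections
in `A`. -/
structure IsOrthogonalPartialIsometry (A : StarSubalgebra ℂ M) (v : M) : Prop where
  ne_zero : v ≠ 0
  isStarProjection_final : IsStarProjection (v * star v)
  isStarProjection_initial : IsStarProjection (star v * v)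
  final_mem : v * star v ∈ A
  initial_mem : star v * v ∈ A
  orthogonal : (v * star v) * (star v * v) = 0

/-- `δ(vAv*, A) = sup {‖x - E_A(x)‖₂ : x ∈ vAv*, ‖x‖ ≤ 1}`. -/
noncomputable def popaDist (τ : M →ₗ[ℂ] ℂ) (A : StarSubalgebra ℂ M) (v : M) : ℝ :=
  sSup {r : ℝ | ∃ y ∈ A, ‖v * y * star v‖ ≤ 1 ∧
    r = twoNorm τ (v * y * star v - condExp τ A (v * y * star v))}

/-- Popa's invariant `δ(A)`: the largest `c` such that `δ(vAv*, A) ≥ c ‖v*v‖₂` for all nonzero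
partial isometries `v ∈ M` for which `v v*` and `v* v` are orthogonal projections in `A`. -/
noncomputable def popaInvariant (τ : M →ₗ[ℂ] ℂ) (A : StarSubalgebra ℂ M) : ℝ :=
  sSup {c : ℝ | ∀ v : M, IsOrthogonalPartialIsometry A v →
    c * twoNorm τ (star v * v) ≤ popaDist τ A v}

end Abstract

/-! ## Von Neumann algebras of discrete groups -/

/-- The von Neumann algebra on `H` generated by a set `S` of operators, that is, the double commutant
of `S ∪ S*`. -/
noncomputable def vonNeumannGenerated {H : Type*} [NormedAddCommGroup H] [InnerProductSpace ℂ H]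
    [CompleteSpace H] (S : Set (H →L[ℂ] H)) : VonNeumannAlgebra H where
  toStarSubalgebra :=
    StarSubalgebra.centralizer ℂ (StarSubalgebra.centralizer ℂ S : Set (H →L[ℂ] H))
  centralizer_centralizer' := by
    change Set.centralizer (Set.centralizer (StarSubalgebra.centralizer ℂ
      (StarSubalgebra.centralizer ℂ S : Set (H →L[ℂ] H)) : Set (H →L[ℂ] H))) =
      (StarSubalgebra.centralizer ℂ (StarSubalgebra.centralizer ℂ S : Set (H →L[ℂ] H)) :
        Set (H →L[ℂ] H))
    simp

section Group

variable (Γ : Type*) [Group Γ]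

/-- The Hilbert space `ℓ²(Γ)`. -/
abbrev EllTwo : Type _ := lp (fun _ : Γ => ℂ) 2

variable {Γ}

theorem memlp_translate (g : Γ) (f : EllTwo Γ) :
    Memℓp (fun h : Γ => f (g⁻¹ * h)) 2 := by
  have hf : Memℓp (fun h : Γ => f h) 2 := lp.memℓp f
  rw [memℓp_gen_iff (by norm_num)] at hf ⊢
  exact (Equiv.mulLeft g⁻¹).summable_iff.mpr hf

/-- The left regular representation `(λ(g) f)(h) = f(g⁻¹ h)`, so that `λ(g) δ_h = δ_{gh}`, as a
linear isometry of `ℓ²(Γ)`. -/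
noncomputable def leftRegularIsometry (g : Γ) : EllTwo Γ →ₗᵢ[ℂ] EllTwo Γ where
  toFun f := ⟨fun h => f (g⁻¹ * h), memlp_translate g f⟩
  map_add' _ _ := rfl
  map_smul' _ _ := rfl
  norm_map' f := by
    rw [lp.norm_eq_tsum_rpow (by norm_num), lp.norm_eq_tsum_rpow (by norm_num)]
    congr 1
    exact (Equiv.mulLeft g⁻¹).tsum_eq (fun h => ‖f h‖ ^ (2 : ENNReal).toReal)

/-- The operator `λ(g)` on `ℓ²(Γ)`. -/
noncomputable def leftRegular (g : Γ) : EllTwo Γ →L[ℂ] EllTwo Γ :=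
  (leftRegularIsometry g).toContinuousLinearMap

variable (Γ)

/-- The von Neumann algebra of the discrete group `Γ`, generated by the operators `λ(g)`. -/
noncomputable def groupVN : VonNeumannAlgebra (EllTwo Γ) :=
  vonNeumannGenerated (Set.range (leftRegular (Γ := Γ)))

/-- `VN(Γ)` as a type. -/
abbrev VN : Type _ := (groupVN Γ).toStarSubalgebra

open Classical in
/-- The canonical normalized trace `x ↦ ⟨δ_e, x δ_e⟩` of `VN(Γ)` (the inner product is linear in the
second variable). -/
noncomputable def groupTrace : VN Γ →ₗ[ℂ] ℂ where
  toFun x := inner ℂ (lp.single 2 (1 : Γ) (1 : ℂ) : EllTwo Γ)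
    ((x : EllTwo Γ →L[ℂ] EllTwo Γ) (lp.single 2 (1 : Γ) (1 : ℂ)))
  map_add' x y := by simp
  map_smul' c x := by simp

variable {Γ}

/-- The von Neumann algebra generated by `λ(a)` is contained in `VN(Γ)`. -/
theorem vonNeumannGenerated_leftRegular_le (a : Γ) :
    (vonNeumannGenerated {leftRegular a}).toStarSubalgebra ≤ (groupVN Γ).toStarSubalgebra :=
  StarSubalgebra.centralizer_le _ _ _ (StarSubalgebra.centralizer_le _ _ _
    (Set.singleton_subset_iff.mpr (Set.mem_range_self a)))

/-- The von Neumann subalgebra of `VN(Γ)` generated by the element `a` of `Γ`. -/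
noncomputable def elementSubalgebra (a : Γ) : StarSubalgebra ℂ (VN Γ) :=
  (vonNeumannGenerated {leftRegular a}).toStarSubalgebra.comap (groupVN Γ).toStarSubalgebra.subtype

end Group

/-! ## Words in free groups -/

section FreeGroupWords

/-! Everything rests on one combinatorial property of the generator `a`: if `g ∉ ⟨a⟩`, then `g`
conjugates no nontrivial power of `a` into `⟨a⟩` (`isMalnormalElement_of`). An element `x` of
`VN(Γ)` is determined by its square summable coefficient function `x δ_1`, and malnormality turns
square summability into vanishing statements.

If `x` commutes with `λ(a)`, its coefficients are constant on the orbits of conjugation by `a`.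
These are infinite off `⟨a⟩`, so `x` is supported on `⟨a⟩`, which forces `x ∈ A`. Hence the relative
commutant of `λ(a)` is `A`, and `A` is a masa. The expectation `E` exists by the mean ergodic
theorem for conjugation by `λ(a)`, and on coefficients it is restriction to `⟨a⟩`.

The sets `⟨a⟩ h⁻¹ a^{-k}` are pairwise disjoint for `h ∉ ⟨a⟩`. This gives the asymptotic
homomorphism property `‖E(x λ(a^k) y) - E(x) λ(a^k) E(y)‖₂ → 0` (`IsCondExp.tendsto_twoNorm`).
Strong singularity follows by testing on `u λ(a^k) u*`, where `‖E(u λ(a^k) u*)‖₂` is asymptotically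
at most `‖E(u)‖₂`. For the Popa invariant, orthogonality of the two projections gives `E(v) = 0`, so
`E(v λ(a^k) v*) → 0` and the distance is exactly `‖v*v‖₂`.

The value `1` also requires that some admissible `v` exist. Two distinct generators provide
traceless symmetries `s ∈ A` and `t`. By a ping-pong argument the positive powers of `st` are
traceless, so `i(st - ts)` is injective. Its sign `w` is a symmetry anticommuting with `s`, hence
exchanging the spectral projections `p = (1 + s)/2` and `1 - p` of `s`; take `v = wp`. -/

theorem of_inv_eq_mk {ι : Type*} (i : ι) : (FreeGroup.of i)⁻¹ = FreeGroup.mk [(i, false)] := by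
  simp [FreeGroup.of, FreeGroup.inv_mk, FreeGroup.invRev]

variable {ι : Type*} [DecidableEq ι]

/-- The elements of the free group whose reduced word begins with a power of the generator `i`. -/
def beginsWith (i : ι) : Set (FreeGroup ι) :=
  {g | ∃ b : Bool, g.toWord.head? = some (i, b)}

theorem one_notMem_beginsWith (i : ι) : (1 : FreeGroup ι) ∉ beginsWith i := by
  simp [beginsWith]

theorem disjoint_beginsWith {i j : ι} (hij : i ≠ j) {g : FreeGroup ι} (hg : g ∈ beginsWith i) :
    g ∉ beginsWith j := by
  rintro ⟨c, hc⟩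
  obtain ⟨b, hb⟩ := hg
  rw [hb] at hc
  simp at hc
  exact hij hc.1

theorem toWord_letter_mul_of_head_ne {x : ι × Bool} {g : FreeGroup ι}
    (h : g.toWord.head? ≠ some (x.1, !x.2)) :
    (FreeGroup.mk [x] * g).toWord = x :: g.toWord := by
  rw [FreeGroup.toWord_mul, FreeGroup.toWord_mk, FreeGroup.reduce_singleton, List.singleton_append,
    FreeGroup.reduce.cons, FreeGroup.reduce_toWord]
  cases hw : g.toWord with
  | nil => rfl
  | cons y t =>
    rw [hw] at h
    have : ¬ (x.1 = y.1 ∧ x.2 = !y.2) := by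
      rintro ⟨h1, h2⟩
      apply h
      simp [h1, h2]
    simp [this]

theorem toWord_letter_mul_of_head_eq {x : ι × Bool} {g : FreeGroup ι} {t : List (ι × Bool)}
    (h : g.toWord = (x.1, !x.2) :: t) :
    (FreeGroup.mk [x] * g).toWord = t := by
  rw [FreeGroup.toWord_mul, FreeGroup.toWord_mk, FreeGroup.reduce_singleton, List.singleton_append,
    FreeGroup.reduce.cons, FreeGroup.reduce_toWord, h]
  simp

/-- No cancellation ever occurs: the first letter met is either for another generator or equal to
`x`, never the inverse of `x`. -/
theorem letter_pow_mul_head {x : ι × Bool} {g : FreeGroup ι} (hg : g ∉ beginsWith x.1) (n : ℕ) :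
    (FreeGroup.mk [x] ^ (n + 1) * g).toWord.head? = some x := by
  induction n with
  | zero =>
    rw [zero_add, pow_one, toWord_letter_mul_of_head_ne (fun h => hg ⟨_, h⟩)]
    rfl
  | succ n ih =>
    rw [pow_succ', mul_assoc, toWord_letter_mul_of_head_ne]
    · rfl
    · rw [ih]
      intro h
      have := congrArg Prod.snd (Option.some.inj h)
      simp at this

theorem zpow_mul_mem_beginsWith {i : ι} {g : FreeGroup ι} (hg : g ∉ beginsWith i) {m : ℤ}
    (hm : m ≠ 0) : FreeGroup.of i ^ m * g ∈ beginsWith i := by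
  obtain ⟨n, rfl | rfl⟩ := m.eq_nat_or_neg
  · obtain ⟨k, rfl⟩ := Nat.exists_eq_succ_of_ne_zero (n := n) (by simpa using hm)
    refine ⟨true, ?_⟩
    rw [zpow_natCast]
    exact letter_pow_mul_head (x := (i, true)) hg k
  · obtain ⟨k, rfl⟩ := Nat.exists_eq_succ_of_ne_zero (n := n) (by simpa using hm)
    refine ⟨false, ?_⟩
    rw [zpow_neg, zpow_natCast, ← inv_pow, of_inv_eq_mk]
    exact letter_pow_mul_head (x := (i, false)) hg k

/-- Strip leading letters `i^{±1}` one at a time, by induction on the length of the word. -/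
theorem exists_zpow_mul_notMem_beginsWith (i : ι) (g : FreeGroup ι) :
    ∃ r : ℤ, FreeGroup.of i ^ r * g ∉ beginsWith i := by
  induction hn : g.toWord.length using Nat.strong_induction_on generalizing g with
  | _ n ih =>
    by_cases hg : g ∈ beginsWith i
    · obtain ⟨b, hb⟩ := hg
      obtain ⟨t, ht⟩ := List.head?_eq_some_iff.mp hb
      have hlen : (FreeGroup.mk [(i, !b)] * g).toWord.length < n := by
        rw [toWord_letter_mul_of_head_eq (x := (i, !b)) (t := t) (by simpa using ht), ← hn, ht]
        simp
      obtain ⟨r, hr⟩ := ih _ hlen _ rfl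
      cases b with
      | true =>
        refine ⟨r - 1, ?_⟩
        rwa [zpow_sub_one, mul_assoc, of_inv_eq_mk]
      | false =>
        refine ⟨r + 1, ?_⟩
        rwa [zpow_add_one, mul_assoc]
    · exact ⟨0, by simpa using hg⟩

/-- Left multiplication by a letter only affects the front of the word. The last letter could change
only for the empty word or a single cancelled letter, both of which are powers of the generator. -/
theorem getLast?_letter_mul {i : ι} {g : FreeGroup ι}
    (hg : g ∉ Subgroup.zpowers (FreeGroup.of i)) (b : Bool) :
    (FreeGroup.mk [(i, b)] * g).toWord.getLast? = g.toWord.getLast? := by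
  by_cases h : g.toWord.head? = some (i, !b)
  · obtain ⟨t, ht⟩ := List.head?_eq_some_iff.mp h
    rw [toWord_letter_mul_of_head_eq (x := (i, b)) ht, ht]
    cases t with
    | nil =>
      exfalso
      apply hg
      have : g = FreeGroup.mk [(i, !b)] := by rw [← ht, FreeGroup.mk_toWord]
      rw [this]
      cases b with
      | true => exact of_inv_eq_mk i ▸ inv_mem (Subgroup.mem_zpowers _)
      | false => exact Subgroup.mem_zpowers _
    | cons y t => simp
  · rw [toWord_letter_mul_of_head_ne (x := (i, b)) h]
    cases hw : g.toWord with
    | nil =>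
      rw [FreeGroup.toWord_eq_nil_iff] at hw
      exact absurd (hw ▸ one_mem _) hg
    | cons y t => simp

theorem getLast?_pow_mul {i : ι} {g : FreeGroup ι}
    (hg : g ∉ Subgroup.zpowers (FreeGroup.of i)) (m : ℤ) :
    (FreeGroup.of i ^ m * g).toWord.getLast? = g.toWord.getLast? := by
  have hmem : ∀ m : ℤ, FreeGroup.of i ^ m * g ∉ Subgroup.zpowers (FreeGroup.of i) := fun m h =>
    hg ((Subgroup.mul_mem_cancel_left _ (Subgroup.zpow_mem_zpowers _ m)).mp h)
  induction m with
  | zero => simp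
  | succ n ih =>
    rw [add_comm, zpow_one_add, mul_assoc, ← ih]
    exact getLast?_letter_mul (hmem _) true
  | pred n ih =>
    rw [sub_eq_add_neg, add_comm, zpow_add, zpow_neg_one, mul_assoc, ← ih, of_inv_eq_mk]
    exact getLast?_letter_mul (hmem _) false

theorem inv_mem_beginsWith_iff {i : ι} {g : FreeGroup ι} :
    g⁻¹ ∈ beginsWith i ↔ ∃ b, g.toWord.getLast? = some (i, b) := by
  simp only [beginsWith, Set.mem_ofPred_eq, FreeGroup.toWord_inv, FreeGroup.invRev,
    List.head?_reverse, List.getLast?_map, Option.map_eq_some_iff, Prod.exists, Prod.mk.injEq]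
  constructor
  · rintro ⟨b, j, c, h, rfl, -⟩
    exact ⟨c, h⟩
  · rintro ⟨b, h⟩
    exact ⟨!b, i, b, h, rfl, rfl⟩

/-- The subgroup generated by `a` is malnormal, in the sense that no nontrivial power of `a` is
conjugated into it by an element outside of it. -/
def IsMalnormalElement {Γ : Type*} [Group Γ] (a : Γ) : Prop :=
  ∀ g ∉ Subgroup.zpowers a, ∀ k : ℤ, k ≠ 0 → g * a ^ k * g⁻¹ ∉ Subgroup.zpowers a

/-- Compare last letters. After absorbing a power of `a` on the right, `g'` does not end in
`a^{±1}`. A relation `a^m g' = g' a^k` with `k ≠ 0` is then impossible: the right side ends in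
`a^{±1}`, while the left side ends as `g'` does. -/
theorem isMalnormalElement_of (i : ι) : IsMalnormalElement (FreeGroup.of i) := by
  intro g hg k hk hmem
  obtain ⟨m, hm⟩ := Subgroup.mem_zpowers_iff.mp hmem
  obtain ⟨r, hr⟩ := exists_zpow_mul_notMem_beginsWith i g⁻¹
  set g' := g * FreeGroup.of i ^ (-r) with hg'
  have hinv : FreeGroup.of i ^ r * g⁻¹ = g'⁻¹ := by simp [hg']
  rw [hinv] at hr
  have hmem' : g' ∉ Subgroup.zpowers (FreeGroup.of i) := fun h =>
    hg ((Subgroup.mul_mem_cancel_right _ (Subgroup.zpow_mem_zpowers _ _)).mp h)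
  have hcomm : FreeGroup.of i ^ m * g' = g' * FreeGroup.of i ^ k := by
    rw [hm, hg']
    simp only [mul_assoc, inv_mul_cancel_left, ← zpow_add]
    rw [add_comm]
  have h1 := zpow_mul_mem_beginsWith hr (neg_ne_zero.mpr hk)
  have h2 : FreeGroup.of i ^ (-k) * g'⁻¹ = (FreeGroup.of i ^ m * g')⁻¹ := by
    rw [hcomm]; simp
  rw [h2, inv_mem_beginsWith_iff, getLast?_pow_mul hmem', ← inv_mem_beginsWith_iff] at h1
  exact hr h1

end FreeGroupWords
/-! ## Operators on `ℓ²(Γ)` -/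

section EllTwoBasics

variable {Γ : Type*}

open Classical in
/-- The standard basis vector `δ_g` of `ℓ²(Γ)`. -/
noncomputable def delta (g : Γ) : EllTwo Γ := lp.single 2 g (1 : ℂ)

theorem delta_apply_self (g : Γ) : delta g g = 1 := by
  classical exact lp.single_apply_self _ _ _

theorem delta_apply_ne {g h : Γ} (hne : h ≠ g) : delta g h = 0 := by
  classical exact lp.single_apply_ne _ _ _ hne

theorem inner_delta_left (g : Γ) (ξ : EllTwo Γ) : inner ℂ (delta g) ξ = ξ g := by
  classical
  rw [delta, lp.inner_single_left]
  simp

theorem norm_delta (g : Γ) : ‖delta g‖ = 1 := by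
  classical
  rw [delta, lp.norm_single (by norm_num)]
  simp

theorem hasSum_smul_delta (ξ : EllTwo Γ) : HasSum (fun g => ξ g • delta g) ξ := by
  classical
  convert lp.hasSum_single (E := fun _ : Γ => ℂ) (by norm_num) ξ using 2 with g
  rw [delta, ← lp.single_smul]
  simp

theorem hasSum_apply_delta (x : EllTwo Γ →L[ℂ] EllTwo Γ) (ξ : EllTwo Γ) (h : Γ) :
    HasSum (fun g => ξ g * x (delta g) h) (x ξ h) := by
  have := ((hasSum_smul_delta ξ).mapL x).mapL (innerSL ℂ (delta h))
  simpa [inner_delta_left] using this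

theorem dense_span_delta :
    (Submodule.span ℂ (Set.range (delta : Γ → EllTwo Γ))).topologicalClosure = ⊤ := by
  rw [eq_top_iff]
  intro ξ _
  refine mem_closure_of_tendsto (hasSum_smul_delta ξ) (Filter.Eventually.of_forall fun s => ?_)
  exact Submodule.sum_mem _ fun g _ =>
    Submodule.smul_mem _ _ (Submodule.subset_span (Set.mem_range_self g))

theorem clm_ext_delta {x y : EllTwo Γ →L[ℂ] EllTwo Γ} (h : ∀ g, x (delta g) = y (delta g)) :
    x = y := by
  ext ξ g
  refine (hasSum_apply_delta x ξ g).unique ?_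
  simp only [h]
  exact hasSum_apply_delta y ξ g

theorem summable_norm_sq (ξ : EllTwo Γ) : Summable fun g => ‖ξ g‖ ^ 2 := by
  have := (memℓp_gen_iff (p := 2) (by norm_num)).mp (lp.memℓp ξ)
  simpa using this

theorem norm_sq_eq_tsum (ξ : EllTwo Γ) : ‖ξ‖ ^ 2 = ∑' g, ‖ξ g‖ ^ 2 := by
  have := lp.norm_rpow_eq_tsum (p := 2) (by norm_num) ξ
  simpa using this

theorem norm_eq_of_norm_apply_perm {ξ η : EllTwo Γ} (σ : Equiv.Perm Γ)
    (h : ∀ g, ‖ξ g‖ = ‖η (σ g)‖) : ‖ξ‖ = ‖η‖ := by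
  rw [← sq_eq_sq₀ (norm_nonneg _) (norm_nonneg _), norm_sq_eq_tsum, norm_sq_eq_tsum,
    ← σ.tsum_eq (fun g => ‖η g‖ ^ 2)]
  simp only [h]

/-- A vector of `ℓ²(Γ)` vanishes wherever its modulus is repeated infinitely often. -/
theorem apply_eq_zero_of_injective (ξ : EllTwo Γ) (σ : ℕ → Γ) (hσ : Function.Injective σ) {c : ℂ}
    (hc : ∀ n, ξ (σ n) = c) : c = 0 := by
  have := ((summable_norm_sq ξ).comp_injective hσ).tendsto_atTop_zero
  simp only [Function.comp_def, hc] at this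
  simpa using tendsto_nhds_unique tendsto_const_nhds this

theorem memlp_perm (σ : Equiv.Perm Γ) (f : EllTwo Γ) : Memℓp (fun h : Γ => f (σ h)) 2 := by
  have hf : Memℓp (fun h : Γ => f h) 2 := lp.memℓp f
  rw [memℓp_gen_iff (by norm_num)] at hf ⊢
  exact σ.summable_iff.mpr hf

/-- The unitary operator of `ℓ²(Γ)` given by a permutation of `Γ`, as a linear isometry. -/
noncomputable def permIsometry (σ : Equiv.Perm Γ) : EllTwo Γ →ₗᵢ[ℂ] EllTwo Γ where
  toFun f := ⟨fun h => f (σ h), memlp_perm σ f⟩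
  map_add' _ _ := rfl
  map_smul' _ _ := rfl
  norm_map' f := by
    rw [lp.norm_eq_tsum_rpow (by norm_num), lp.norm_eq_tsum_rpow (by norm_num)]
    congr 1
    exact σ.tsum_eq (fun h => ‖f h‖ ^ (2 : ENNReal).toReal)

/-- The unitary operator of `ℓ²(Γ)` given by a permutation of `Γ`. -/
noncomputable def permOp (σ : Equiv.Perm Γ) : EllTwo Γ →L[ℂ] EllTwo Γ :=
  (permIsometry σ).toContinuousLinearMap

@[simp] theorem permOp_apply (σ : Equiv.Perm Γ) (ξ : EllTwo Γ) (h : Γ) :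
    permOp σ ξ h = ξ (σ h) := rfl

theorem norm_permOp_apply (σ : Equiv.Perm Γ) (ξ : EllTwo Γ) : ‖permOp σ ξ‖ = ‖ξ‖ :=
  (permIsometry σ).norm_map ξ

theorem permOp_delta (σ : Equiv.Perm Γ) (g : Γ) : permOp σ (delta g) = delta (σ.symm g) := by
  ext h
  rw [permOp_apply]
  by_cases hg : h = σ.symm g
  · subst hg
    simp [delta_apply_self]
  · rw [delta_apply_ne hg, delta_apply_ne]
    rintro rfl
    simp at hg

end EllTwoBasics

/-! ### Translations and the coefficient function `x δ_1` of an element of `VN(Γ)`. -/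

section GroupOperators

variable {Γ : Type*} [Group Γ]

@[simp] theorem leftRegular_apply (g : Γ) (ξ : EllTwo Γ) (h : Γ) :
    leftRegular g ξ h = ξ (g⁻¹ * h) := rfl

theorem leftRegular_delta (g h : Γ) : leftRegular g (delta h) = delta (g * h) := by
  ext k
  rw [leftRegular_apply]
  by_cases hk : k = g * h
  · subst hk
    simp [delta_apply_self]
  · rw [delta_apply_ne hk, delta_apply_ne]
    rintro rfl
    simp at hk

theorem leftRegular_mul (g h : Γ) :
    leftRegular (g * h) = leftRegular g * leftRegular h := by
  ext ξ k
  simp [mul_assoc]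

theorem leftRegular_one : leftRegular (1 : Γ) = 1 := by
  ext ξ k
  simp

theorem star_leftRegular (g : Γ) : star (leftRegular g) = leftRegular g⁻¹ := by
  rw [ContinuousLinearMap.star_eq_adjoint]
  refine clm_ext_delta fun h => ?_
  ext k
  rw [← inner_delta_left, ContinuousLinearMap.adjoint_inner_right, leftRegular_delta,
    inner_delta_left, leftRegular_delta]
  by_cases hk : h = g * k
  · subst hk
    simp [delta_apply_self]
  · rw [delta_apply_ne (Ne.symm hk), delta_apply_ne]
    rintro rfl
    simp at hk

theorem norm_leftRegular_apply (g : Γ) (ξ : EllTwo Γ) : ‖leftRegular g ξ‖ = ‖ξ‖ :=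
  (leftRegularIsometry g).norm_map ξ

/-- `ρ(g)`, the right translation `(ρ(g) ξ)(h) = ξ(h g)`, so that `ρ(g) δ_h = δ_{h g⁻¹}`. -/
noncomputable def rightRegular (g : Γ) : EllTwo Γ →L[ℂ] EllTwo Γ := permOp (Equiv.mulRight g)

@[simp] theorem rightRegular_apply (g : Γ) (ξ : EllTwo Γ) (h : Γ) :
    rightRegular g ξ h = ξ (h * g) := rfl

theorem rightRegular_inv_delta_one (g : Γ) : rightRegular g⁻¹ (delta 1) = delta g := by
  rw [rightRegular, permOp_delta]
  simp

theorem rightRegular_mul_leftRegular (g h : Γ) :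
    rightRegular g * leftRegular h = leftRegular h * rightRegular g := by
  ext ξ k
  simp [mul_assoc]

theorem mem_centralizer_iff {H : Type*} [NormedAddCommGroup H] [InnerProductSpace ℂ H]
    [CompleteSpace H] {S : Set (H →L[ℂ] H)} {x : H →L[ℂ] H} :
    x ∈ StarSubalgebra.centralizer ℂ S ↔ ∀ g ∈ S, g * x = x * g ∧ star g * x = x * star g :=
  StarSubalgebra.mem_centralizer_iff ℂ

theorem mem_vonNeumannGenerated_iff {H : Type*} [NormedAddCommGroup H] [InnerProductSpace ℂ H]
    [CompleteSpace H] {S : Set (H →L[ℂ] H)} {x : H →L[ℂ] H} :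
    x ∈ (vonNeumannGenerated S).toStarSubalgebra ↔
      ∀ y ∈ StarSubalgebra.centralizer ℂ S, y * x = x * y := by
  change x ∈ StarSubalgebra.centralizer ℂ _ ↔ _
  rw [mem_centralizer_iff]
  exact ⟨fun h y hy => (h y hy).1, fun h y hy => ⟨h y hy, h _ (star_mem hy)⟩⟩

theorem mem_groupVN_iff {x : EllTwo Γ →L[ℂ] EllTwo Γ} :
    x ∈ (groupVN Γ).toStarSubalgebra ↔
      ∀ y : EllTwo Γ →L[ℂ] EllTwo Γ,
        (∀ g : Γ, leftRegular g * y = y * leftRegular g) → y * x = x * y := by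
  rw [groupVN, mem_vonNeumannGenerated_iff]
  refine forall_congr' fun y => imp_congr_left ?_
  rw [mem_centralizer_iff]
  constructor
  · exact fun h g => (h _ (Set.mem_range_self g)).1
  · rintro h _ ⟨g, rfl⟩
    exact ⟨h g, by rw [star_leftRegular]; exact h _⟩

theorem leftRegular_mem_groupVN (g : Γ) : leftRegular g ∈ (groupVN Γ).toStarSubalgebra :=
  mem_groupVN_iff.mpr fun _ hy => (hy g).symm

theorem rightRegular_mul_eq {x : EllTwo Γ →L[ℂ] EllTwo Γ}
    (hx : x ∈ (groupVN Γ).toStarSubalgebra) (g : Γ) :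
    rightRegular g * x = x * rightRegular g :=
  mem_groupVN_iff.mp hx _ fun h => (rightRegular_mul_leftRegular g h).symm

theorem apply_delta_eq {x : EllTwo Γ →L[ℂ] EllTwo Γ}
    (hx : x ∈ (groupVN Γ).toStarSubalgebra) (g : Γ) :
    x (delta g) = rightRegular g⁻¹ (x (delta 1)) := by
  rw [← rightRegular_inv_delta_one g]
  exact (DFunLike.congr_fun (rightRegular_mul_eq hx g⁻¹) (delta 1)).symm

/-- Commutation with right translations makes the matrix of `x` depend only on `h g⁻¹`; all later
estimates are read off from this one coefficient function. -/
theorem apply_delta_apply {x : EllTwo Γ →L[ℂ] EllTwo Γ}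
    (hx : x ∈ (groupVN Γ).toStarSubalgebra) (g h : Γ) :
    x (delta g) h = x (delta 1) (h * g⁻¹) := by
  rw [apply_delta_eq hx, rightRegular_apply]

/-- The vector `δ_1` is separating, since right translations carry it to every basis vector. -/
theorem groupVN_ext {x y : EllTwo Γ →L[ℂ] EllTwo Γ}
    (hx : x ∈ (groupVN Γ).toStarSubalgebra) (hy : y ∈ (groupVN Γ).toStarSubalgebra)
    (h : x (delta 1) = y (delta 1)) : x = y :=
  clm_ext_delta fun g => by rw [apply_delta_eq hx, apply_delta_eq hy, h]

theorem star_apply_delta_one_apply {x : EllTwo Γ →L[ℂ] EllTwo Γ}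
    (hx : x ∈ (groupVN Γ).toStarSubalgebra) (g : Γ) :
    star x (delta 1) g = star (x (delta 1) g⁻¹) := by
  rw [← inner_delta_left, ContinuousLinearMap.star_eq_adjoint,
    ContinuousLinearMap.adjoint_inner_right, ← inner_conj_symm, inner_delta_left,
    apply_delta_apply hx, one_mul]
  rfl

theorem groupTrace_apply (x : VN Γ) :
    groupTrace Γ x = inner ℂ (delta 1) (x.1 (delta 1)) := rfl

theorem groupTrace_eq_coeff (x : VN Γ) : groupTrace Γ x = x.1 (delta 1) 1 := by
  rw [groupTrace_apply, inner_delta_left]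

theorem groupTrace_star_mul (x y : VN Γ) :
    groupTrace Γ (star x * y) = inner ℂ (x.1 (delta 1)) (y.1 (delta 1)) := by
  rw [groupTrace_apply]
  change inner ℂ _ (star x.1 (y.1 _)) = _
  rw [ContinuousLinearMap.star_eq_adjoint, ContinuousLinearMap.adjoint_inner_right]

theorem twoNorm_eq (x : VN Γ) : twoNorm (groupTrace Γ) x = ‖x.1 (delta 1)‖ := by
  rw [twoNorm, groupTrace_star_mul, inner_self_eq_norm_sq_to_K]
  norm_cast
  exact Real.sqrt_sq (norm_nonneg _)

theorem groupTrace_mul_comm (x y : VN Γ) : groupTrace Γ (x * y) = groupTrace Γ (y * x) := by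
  have key : ∀ x y : VN Γ, groupTrace Γ (x * y) =
      ∑' g, y.1 (delta 1) g * x.1 (delta 1) g⁻¹ := fun x y => by
    rw [← star_star x, groupTrace_star_mul, lp.inner_eq_tsum, star_star]
    refine tsum_congr fun g => ?_
    change inner ℂ (star x.1 (delta 1) g) _ = _
    rw [star_apply_delta_one_apply x.2]
    simp
  rw [key, key, ← (Equiv.inv Γ).tsum_eq]
  refine tsum_congr fun g => ?_
  simp [mul_comm]

end GroupOperators
/-! ## The subalgebra generated by a malnormal element -/

section ElementSubalgebra

variable {Γ : Type*} [Group Γ]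

theorem commute_leftRegular_zpow {a : Γ} {y : EllTwo Γ →L[ℂ] EllTwo Γ}
    (hy : Commute (leftRegular a) y) (k : ℤ) : Commute (leftRegular (a ^ k)) y := by
  have hinv : Commute (leftRegular a⁻¹) y := by
    have h1 : leftRegular a * leftRegular a⁻¹ = 1 := by
      rw [← leftRegular_mul, mul_inv_cancel, leftRegular_one]
    have h2 : leftRegular a⁻¹ * leftRegular a = 1 := by
      rw [← leftRegular_mul, inv_mul_cancel, leftRegular_one]
    calc leftRegular a⁻¹ * y = leftRegular a⁻¹ * y * (leftRegular a * leftRegular a⁻¹) := by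
          rw [h1, mul_one]
      _ = leftRegular a⁻¹ * (y * leftRegular a) * leftRegular a⁻¹ := by simp only [mul_assoc]
      _ = leftRegular a⁻¹ * leftRegular a * y * leftRegular a⁻¹ := by
          rw [← hy.eq]; simp only [mul_assoc]
      _ = y * leftRegular a⁻¹ := by rw [h2, one_mul]
  induction k with
  | zero => simp [leftRegular_one]
  | succ n ih => rw [zpow_add_one, leftRegular_mul]; exact ih.mul_left hy
  | pred n ih => rw [zpow_sub_one, leftRegular_mul]; exact ih.mul_left hinv

theorem coeff_conj_of_commute {a : Γ} {x : EllTwo Γ →L[ℂ] EllTwo Γ}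
    (hx : x ∈ (groupVN Γ).toStarSubalgebra) (hc : Commute (leftRegular a) x) (n : ℤ) (g : Γ) :
    x (delta 1) (a ^ n * g * (a ^ n)⁻¹) = x (delta 1) g := by
  have h := congrArg (fun ξ : EllTwo Γ => ξ (a ^ n * g))
    (DFunLike.congr_fun (commute_leftRegular_zpow hc n).eq (delta 1))
  simp only [mul_apply_eq_comp, leftRegular_delta, mul_one, leftRegular_apply,
    inv_mul_cancel_left] at h
  rw [h, apply_delta_apply hx (a ^ n)]

/-- The coefficients are constant along the conjugates `a^n g a^{-n}`, which are pairwise distinct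
by malnormality, and a square summable function cannot have a nonzero constant value on an infinite
set. -/
theorem coeff_eq_zero_of_commute {a : Γ} (ha : IsMalnormalElement a)
    {x : EllTwo Γ →L[ℂ] EllTwo Γ} (hx : x ∈ (groupVN Γ).toStarSubalgebra)
    (hc : Commute (leftRegular a) x) {g : Γ} (hg : g ∉ Subgroup.zpowers a) :
    x (delta 1) g = 0 := by
  refine apply_eq_zero_of_injective (x (delta 1)) (fun n : ℕ => a ^ (n : ℤ) * g * (a ^ (n : ℤ))⁻¹)
    (fun m n hmn => ?_) (fun n => coeff_conj_of_commute hx hc n g)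
  by_contra hne
  -- Two equal conjugates would make `g` commute with `a^{m-n}`, so that `g⁻¹` conjugates this
  -- nontrivial power into `⟨a⟩`.
  refine ha g⁻¹ (by simpa using hg) ((m : ℤ) - n) (sub_ne_zero.mpr (by exact_mod_cast hne)) ?_
  have : g⁻¹ * a ^ ((m : ℤ) - n) * g⁻¹⁻¹ = a ^ ((m : ℤ) - n) := by
    have h1 : a ^ (m : ℤ) * g = a ^ (n : ℤ) * g * (a ^ (n : ℤ))⁻¹ * a ^ (m : ℤ) :=
      eq_mul_of_mul_inv_eq hmn
    have h2 : a ^ ((m : ℤ) - n) * g = g * a ^ ((m : ℤ) - n) := by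
      rw [sub_eq_neg_add, zpow_add, mul_assoc, h1]
      simp [mul_assoc]
    rw [inv_inv, mul_assoc, h2, inv_mul_cancel_left]
  rw [this]
  exact Subgroup.zpow_mem_zpowers a _

theorem mem_elementSubalgebra {a : Γ} {x : VN Γ} :
    x ∈ elementSubalgebra a ↔
      ∀ y : EllTwo Γ →L[ℂ] EllTwo Γ, Commute (leftRegular a) y → y * x.1 = x.1 * y := by
  change x.1 ∈ (vonNeumannGenerated {leftRegular a}).toStarSubalgebra ↔ _
  rw [mem_vonNeumannGenerated_iff]
  refine forall_congr' fun y => imp_congr_left ?_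
  rw [mem_centralizer_iff]
  simp only [Set.mem_singleton_iff, forall_eq, star_leftRegular]
  refine ⟨fun h => h.1, fun h => ⟨h, ?_⟩⟩
  simpa using (commute_leftRegular_zpow h (-1)).eq

theorem leftRegular_zpow_mem_elementSubalgebra (a : Γ) (k : ℤ) :
    (⟨leftRegular (a ^ k), leftRegular_mem_groupVN _⟩ : VN Γ) ∈ elementSubalgebra a :=
  mem_elementSubalgebra.mpr fun _ hy => (commute_leftRegular_zpow hy k).eq.symm

theorem commute_of_mem_elementSubalgebra {a : Γ} {x : VN Γ} (hx : x ∈ elementSubalgebra a) :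
    Commute (leftRegular a) x.1 :=
  mem_elementSubalgebra.mp hx _ (Commute.refl _)

/-- The relative commutant of a malnormal element of `Γ` in `VN(Γ)` is the von Neumann algebra
generated by it. -/
theorem mem_elementSubalgebra_of_commute {a : Γ} (ha : IsMalnormalElement a) {x : VN Γ}
    (hc : Commute (leftRegular a) x.1) : x ∈ elementSubalgebra a := by
  refine mem_elementSubalgebra.mpr fun y hy => clm_ext_delta fun g => ?_
  ext k
  -- Both `yx` and `xy` are expanded as sums over `h` weighted by the coefficient of `x` at `h`, via
  -- the substitutions `hg` and `h⁻¹k`. The terms agree for `h ∈ ⟨a⟩` because `y` commutes with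
  -- `λ(h)`, and vanish for the other `h`.
  have h1 := hasSum_apply_delta y (x.1 (delta g)) k
  have h2 := hasSum_apply_delta x.1 (y (delta g)) k
  rw [← (Equiv.mulRight g).hasSum_iff] at h1
  rw [← ((Equiv.inv Γ).trans (Equiv.mulRight k)).hasSum_iff] at h2
  refine h1.unique (Eq.mp (congrArg (fun f => HasSum f _) ?_) h2)
  symm
  funext h
  simp only [Function.comp_apply, Equiv.coe_mulRight, Equiv.trans_apply, Equiv.inv_apply]
  rw [apply_delta_apply x.2, apply_delta_apply x.2 (h⁻¹ * k)]
  simp only [mul_inv_cancel_right, mul_inv_rev, inv_inv, mul_inv_cancel_left]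
  by_cases hh : h ∈ Subgroup.zpowers a
  · obtain ⟨n, rfl⟩ := Subgroup.mem_zpowers_iff.mp hh
    rw [← leftRegular_delta, mul_comm]
    congr 1
    exact (congrArg (fun ξ : EllTwo Γ => ξ k)
      (DFunLike.congr_fun (commute_leftRegular_zpow hy n).eq (delta g))).symm
  · rw [coeff_eq_zero_of_commute ha x.2 hc hh, zero_mul, mul_zero]

theorem isMasa_elementSubalgebra {a : Γ} (ha : IsMalnormalElement a) :
    IsMasa (M := VN Γ) (elementSubalgebra a) := by
  refine ⟨fun x hx y hy => Subtype.ext ?_, fun B hB hAB x hx => ?_⟩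
  · exact mem_elementSubalgebra.mp hy _ (commute_of_mem_elementSubalgebra hx)
  · have := hB _ (hAB (leftRegular_zpow_mem_elementSubalgebra a 1)) x hx
    refine mem_elementSubalgebra_of_commute ha ?_
    have h := congrArg Subtype.val this
    change leftRegular (a ^ (1 : ℤ)) * x.1 = x.1 * leftRegular (a ^ (1 : ℤ)) at h
    rwa [zpow_one] at h

end ElementSubalgebra

/-! ## The conditional expectation onto the subalgebra generated by a malnormal element -/

section ConditionalExpectation

/-- A uniform bound extends convergence from the dense span of the `δ_g` to all vectors, and
Banach–Steinhaus makes the pointwise limit bounded. -/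
theorem exists_strong_limit {Γ : Type*} (T : ℕ → EllTwo Γ →L[ℂ] EllTwo Γ) (C : ℝ)
    (hC : ∀ n, ‖T n‖ ≤ C)
    (h : ∀ g, ∃ η, Filter.Tendsto (fun n => T n (delta g)) Filter.atTop (nhds η)) :
    ∃ y : EllTwo Γ →L[ℂ] EllTwo Γ,
      ∀ ξ, Filter.Tendsto (fun n => T n ξ) Filter.atTop (nhds (y ξ)) := by
  have hC0 : 0 ≤ C := (norm_nonneg _).trans (hC 0)
  have hspan : ∀ η ∈ Submodule.span ℂ (Set.range (delta : Γ → EllTwo Γ)),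
      CauchySeq fun n => T n η := by
    intro η hη
    induction hη using Submodule.span_induction with
    | mem η hη =>
      obtain ⟨g, rfl⟩ := hη
      obtain ⟨ζ, hζ⟩ := h g
      exact hζ.cauchySeq
    | zero => simpa using cauchySeq_const (0 : EllTwo Γ)
    | add u v _ _ hu hv =>
      simp only [map_add]
      exact hu.add hv
    | smul c u _ hu =>
      simp only [map_smul]
      exact (uniformContinuous_const_smul c).comp_cauchySeq hu
  have hcauchy : ∀ ξ, CauchySeq fun n => T n ξ := by
    intro ξ
    rw [Metric.cauchySeq_iff]
    intro ε hε
    have hξ : ξ ∈ closure (Submodule.span ℂ (Set.range (delta : Γ → EllTwo Γ)) :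
        Set (EllTwo Γ)) := by
      rw [← Submodule.topologicalClosure_coe, dense_span_delta]
      trivial
    obtain ⟨η, hη, hd⟩ := Metric.mem_closure_iff.mp hξ (ε / (3 * (C + 1))) (by positivity)
    obtain ⟨N, hN⟩ := Metric.cauchySeq_iff.mp (hspan η hη) (ε / 3) (by positivity)
    have hb : ∀ n, dist (T n ξ) (T n η) < ε / 3 := fun n => by
      rw [dist_eq_norm, ← map_sub]
      calc ‖T n (ξ - η)‖ ≤ C * ‖ξ - η‖ := (T n).le_of_opNorm_le (hC n) _
        _ ≤ (C + 1) * ‖ξ - η‖ := by gcongr; linarith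
        _ < (C + 1) * (ε / (3 * (C + 1))) := by
          rw [← dist_eq_norm]; gcongr
        _ = ε / 3 := by field_simp
    refine ⟨N, fun m hm n hn => ?_⟩
    calc dist (T m ξ) (T n ξ) ≤ dist (T m ξ) (T m η) + dist (T m η) (T n η) +
          dist (T n η) (T n ξ) := dist_triangle4 _ _ _ _
      _ < ε / 3 + ε / 3 + ε / 3 := by
        have := hb n
        rw [dist_comm] at this
        exact add_lt_add (add_lt_add (hb m) (hN m hm n hn)) this
      _ = ε := by ring
  choose f hf using fun ξ => cauchySeq_tendsto_of_complete (hcauchy ξ)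
  exact ⟨continuousLinearMapOfTendsto T (tendsto_pi_nhds.mpr hf), hf⟩

variable {Γ : Type*} [Group Γ]

/-- The averages `N⁻¹ ∑_{n < N} λ(a)ⁿ x λ(a)⁻ⁿ`. -/
noncomputable def conjAverage (a : Γ) (N : ℕ) (x : EllTwo Γ →L[ℂ] EllTwo Γ) :
    EllTwo Γ →L[ℂ] EllTwo Γ :=
  (N : ℂ)⁻¹ • ∑ n ∈ Finset.range N, leftRegular (a ^ n) * x * leftRegular (a ^ n)⁻¹

theorem norm_conjAverage_le (a : Γ) (N : ℕ) (x : EllTwo Γ →L[ℂ] EllTwo Γ) :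
    ‖conjAverage a N x‖ ≤ ‖x‖ := by
  have hterm : ∀ g : Γ, ‖leftRegular g * x * leftRegular g⁻¹‖ ≤ ‖x‖ := fun g =>
    ContinuousLinearMap.opNorm_le_bound _ (norm_nonneg _) fun ξ => by
      simp only [mul_apply_eq_comp, norm_leftRegular_apply]
      exact (x.le_opNorm _).trans_eq (by rw [norm_leftRegular_apply])
  rw [conjAverage, norm_smul, norm_inv, Complex.norm_natCast]
  rcases Nat.eq_zero_or_pos N with rfl | hN
  · simp
  · calc (N : ℝ)⁻¹ * ‖∑ n ∈ Finset.range N, leftRegular (a ^ n) * x * leftRegular (a ^ n)⁻¹‖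
        ≤ (N : ℝ)⁻¹ * (N * ‖x‖) := by
          gcongr
          refine (norm_sum_le_of_le _ fun n _ => hterm _).trans ?_
          simp
      _ = ‖x‖ := by
          have : (N : ℝ) ≠ 0 := by positivity
          field_simp

theorem conjAverage_mul_mul {a : Γ} {y z : EllTwo Γ →L[ℂ] EllTwo Γ}
    (hy : Commute (leftRegular a) y) (hz : Commute (leftRegular a) z) (N : ℕ)
    (x : EllTwo Γ →L[ℂ] EllTwo Γ) :
    conjAverage a N (y * x * z) = y * conjAverage a N x * z := by
  simp only [conjAverage, mul_smul_comm, smul_mul_assoc, Finset.mul_sum, Finset.sum_mul]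
  congr 1
  refine Finset.sum_congr rfl fun n _ => ?_
  have h1 := (commute_leftRegular_zpow hy n).eq
  have h2 := (commute_leftRegular_zpow hz (-n)).eq
  rw [zpow_natCast] at h1
  rw [zpow_neg, zpow_natCast] at h2
  calc leftRegular (a ^ n) * (y * x * z) * leftRegular (a ^ n)⁻¹
      = (leftRegular (a ^ n) * y) * x * (z * leftRegular (a ^ n)⁻¹) := by simp only [mul_assoc]
    _ = _ := by rw [h1, ← h2]; simp only [mul_assoc]

theorem conjAverage_mem (a : Γ) (N : ℕ) {x : EllTwo Γ →L[ℂ] EllTwo Γ}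
    (hx : x ∈ (groupVN Γ).toStarSubalgebra) :
    conjAverage a N x ∈ (groupVN Γ).toStarSubalgebra :=
  StarSubalgebra.smul_mem _ (sum_mem fun _ _ =>
    mul_mem (mul_mem (leftRegular_mem_groupVN _) hx) (leftRegular_mem_groupVN _)) _

theorem conjAverage_of_commute {a : Γ} {y : EllTwo Γ →L[ℂ] EllTwo Γ}
    (hy : Commute (leftRegular a) y) {N : ℕ} (hN : N ≠ 0) : conjAverage a N y = y := by
  have := conjAverage_mul_mul hy (Commute.one_right _) N 1
  rw [mul_one, mul_one] at this
  rw [this]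
  have h1 : conjAverage a N 1 = 1 := by
    simp only [conjAverage, mul_one, ← leftRegular_mul, mul_inv_cancel, leftRegular_one]
    rw [Finset.sum_const, Finset.card_range, ← Nat.cast_smul_eq_nsmul ℂ, smul_smul,
      inv_mul_cancel₀ (by exact_mod_cast hN), one_smul]
  rw [h1, mul_one, mul_one]

/-- On coefficient functions, conjugation by `λ(a)` is the unitary that permutes `Γ` by an inner
automorphism, so the mean ergodic theorem applies to the operator averages. -/
theorem birkhoffAverage_apply_delta_one (a : Γ) (N : ℕ) {x : EllTwo Γ →L[ℂ] EllTwo Γ}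
    (hx : x ∈ (groupVN Γ).toStarSubalgebra) :
    birkhoffAverage ℂ (permOp (MulAut.conj a⁻¹).toEquiv) id N (x (delta 1)) =
      conjAverage a N x (delta 1) := by
  have hiter : ∀ (n : ℕ) (ξ : EllTwo Γ) (h : Γ),
      ((permOp (MulAut.conj a⁻¹).toEquiv)^[n] ξ) h = ξ ((a ^ n)⁻¹ * h * a ^ n) := by
    intro n
    induction n with
    | zero => simp
    | succ n ih =>
      intro ξ h
      rw [Function.iterate_succ_apply, ih, permOp_apply]
      simp [pow_succ, mul_assoc]
  rw [birkhoffAverage, birkhoffSum, conjAverage]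
  simp only [id, smul_apply, sum_apply]
  congr 1
  refine Finset.sum_congr rfl fun n _ => ?_
  ext h
  rw [hiter, mul_apply_eq_comp, mul_apply_eq_comp, leftRegular_delta,
    leftRegular_apply, mul_one, apply_delta_apply hx (a ^ n)⁻¹]
  simp

/-- The mean ergodic theorem gives convergence at `δ_1`, right translations carry it to each `δ_g`,
and the averages are bounded by `‖x‖`. -/
theorem exists_limit_conjAverage (a : Γ) {x : EllTwo Γ →L[ℂ] EllTwo Γ}
    (hx : x ∈ (groupVN Γ).toStarSubalgebra) :
    ∃ y : EllTwo Γ →L[ℂ] EllTwo Γ, y ∈ (groupVN Γ).toStarSubalgebra ∧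
      Commute (leftRegular a) y ∧
      ∀ ξ, Filter.Tendsto (fun N => conjAverage a N x ξ) Filter.atTop (nhds (y ξ)) := by
  set U : EllTwo Γ →L[ℂ] EllTwo Γ := permOp (MulAut.conj a⁻¹).toEquiv with hU
  have hU1 : ‖U‖ ≤ 1 := ContinuousLinearMap.opNorm_le_bound _ zero_le_one fun ξ => by
    rw [hU, norm_permOp_apply, one_mul]
  have herg := ContinuousLinearMap.tendsto_birkhoffAverage_orthogonalProjection U hU1
    (x (delta 1))
  simp only [hU, birkhoffAverage_apply_delta_one a _ hx] at herg
  obtain ⟨y, hy⟩ := exists_strong_limit (fun N => conjAverage a N x) ‖x‖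
    (fun N => norm_conjAverage_le a N x) fun g => by
      simp only [apply_delta_eq (conjAverage_mem a _ hx) g]
      exact ⟨_, ((rightRegular g⁻¹).continuous.tendsto _).comp herg⟩
  have hyM : y ∈ (groupVN Γ).toStarSubalgebra := mem_groupVN_iff.mpr fun z hz => by
    ext1 ξ
    refine tendsto_nhds_unique ((z.continuous.tendsto _).comp (hy ξ)) ?_
    refine (hy (z ξ)).congr fun N => ?_
    exact (DFunLike.congr_fun (mem_groupVN_iff.mp (conjAverage_mem a N hx) z hz) ξ).symm
  refine ⟨y, hyM, ?_, hy⟩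
  -- The ergodic limit is the projection onto the fixed vectors of `U`; invariance of the
  -- coefficients under conjugation by `a` is commutation with `λ(a)`.
  have hfix : U (y (delta 1)) = y (delta 1) := by
    rw [tendsto_nhds_unique (hy (delta 1)) herg]
    exact (((U : EllTwo Γ →ₗ[ℂ] EllTwo Γ).eqLocus
      ((1 : EllTwo Γ →L[ℂ] EllTwo Γ) : EllTwo Γ →ₗ[ℂ] EllTwo Γ)).orthogonalProjectionOnto
        (x (delta 1))).2
  refine groupVN_ext (mul_mem (leftRegular_mem_groupVN _) hyM)
    (mul_mem hyM (leftRegular_mem_groupVN _)) ?_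
  ext h
  have := congrArg (fun ξ : EllTwo Γ => ξ (h * a⁻¹)) hfix
  simp only [hU, permOp_apply] at this
  rw [mul_apply_eq_comp, mul_apply_eq_comp, leftRegular_delta,
    leftRegular_apply, mul_one, apply_delta_apply hyM a, ← this]
  simp [mul_assoc]

theorem exists_isCondExp_elementSubalgebra {a : Γ} (ha : IsMalnormalElement a) :
    ∃ E, IsCondExp (groupTrace Γ) (elementSubalgebra a) E := by
  choose E hEM hEc hE using fun x : VN Γ => exists_limit_conjAverage a x.2
  refine ⟨⟨⟨fun x => ⟨E x, hEM x⟩, fun x y => Subtype.ext ?_⟩, fun c x => Subtype.ext ?_⟩,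
    ⟨fun x => mem_elementSubalgebra_of_commute ha (hEc x), fun y hy => Subtype.ext ?_,
      fun y hy z hz x => Subtype.ext ?_, fun x => ?_, fun x => ?_⟩⟩
  · change E (x + y) = E x + E y
    ext1 ξ
    refine tendsto_nhds_unique (hE (x + y) ξ) (((hE x ξ).add (hE y ξ)).congr fun N => ?_)
    simp [conjAverage, mul_add, add_mul, Finset.sum_add_distrib]
  · change E (c • x) = c • E x
    ext1 ξ
    refine tendsto_nhds_unique (hE (c • x) ξ) (((hE x ξ).const_smul c).congr fun N => ?_)
    simp [conjAverage, ← Finset.smul_sum, smul_comm c]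
  · change E y = y.1
    ext1 ξ
    refine tendsto_nhds_unique (hE y ξ) (tendsto_const_nhds.congr' ?_)
    -- The average with `N = 0` is the junk value `0`, so equality holds only eventually.
    filter_upwards [Filter.eventually_ne_atTop 0] with N hN
    rw [conjAverage_of_commute (commute_of_mem_elementSubalgebra hy) hN]
  · change E (y * x * z) = y.1 * E x * z.1
    ext1 ξ
    refine tendsto_nhds_unique (hE (y * x * z) ξ)
      (((y.1.continuous.tendsto _).comp (hE x (z.1 ξ))).congr fun N => ?_)
    have := conjAverage_mul_mul (commute_of_mem_elementSubalgebra hy)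
      (commute_of_mem_elementSubalgebra hz) N x.1
    exact (DFunLike.congr_fun this ξ).symm
  · change ‖E x‖ ≤ ‖x.1‖
    refine ContinuousLinearMap.opNorm_le_bound _ (norm_nonneg _) fun ξ =>
      le_of_tendsto (hE x ξ).norm (Filter.Eventually.of_forall fun N => ?_)
    exact (conjAverage a N x.1).le_of_opNorm_le (norm_conjAverage_le a N x.1) ξ
  · rw [groupTrace_apply, groupTrace_apply]
    refine tendsto_nhds_unique (tendsto_const_nhds.inner (𝕜 := ℂ) (hE x (delta 1)))
      (tendsto_const_nhds.congr' ?_)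
    filter_upwards [Filter.eventually_ne_atTop 0] with N hN
    simp only [inner_delta_left, conjAverage, smul_apply,
      sum_apply, mul_apply_eq_comp, leftRegular_delta]
    rw [lp.coeFn_smul, Pi.smul_apply, lp.coeFn_sum, Finset.sum_apply]
    simp only [leftRegular_apply, apply_delta_apply x.2 (_ * 1)]
    have : (N : ℂ) ≠ 0 := by exact_mod_cast hN
    simp [this]

/-- With `α` the conjugation by `u`, the map `α E α⁻¹` works because `α` preserves the trace and the
norm. -/
theorem IsCondExp.unitaryConj {A : StarSubalgebra ℂ (VN Γ)} {E : VN Γ →ₗ[ℂ] VN Γ}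
    (hE : IsCondExp (groupTrace Γ) A E) (u : unitary (VN Γ)) :
    ∃ F, IsCondExp (groupTrace Γ) (unitaryConj u A) F := by
  set α := Unitary.conjStarAlgAut ℂ (VN Γ) u with hα
  have htr : ∀ x, groupTrace Γ (α x) = groupTrace Γ x := fun x => by
    rw [hα, Unitary.conjStarAlgAut_apply, mul_assoc, groupTrace_mul_comm, mul_assoc,
      Unitary.coe_star_mul_self, mul_one]
  have htr' : ∀ x, groupTrace Γ (α.symm x) = groupTrace Γ x := fun x => by
    rw [← htr, StarAlgEquiv.apply_symm_apply]
  have hnorm : ∀ x, ‖α x‖ = ‖x‖ := fun x => by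
    have hu : u.1.1 ∈ unitary (EllTwo Γ →L[ℂ] EllTwo Γ) :=
      ⟨congrArg Subtype.val u.2.1, congrArg Subtype.val u.2.2⟩
    rw [hα, Unitary.conjStarAlgAut_apply]
    change ‖u.1.1 * x.1 * star u.1.1‖ = ‖x.1‖
    rw [CStarRing.norm_mul_mem_unitary _ (Unitary.star_mem hu), CStarRing.norm_mem_unitary_mul _ hu]
  have hnorm' : ∀ x, ‖α.symm x‖ = ‖x‖ := fun x => by
    rw [← hnorm, StarAlgEquiv.apply_symm_apply]
  have hmem : ∀ {y}, y ∈ _root_.unitaryConj u A → α.symm y ∈ A := by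
    rintro _ ⟨z, hz, rfl⟩
    change α.symm (α z) ∈ A
    rwa [StarAlgEquiv.symm_apply_apply]
  refine ⟨⟨⟨fun x => α (E (α.symm x)), fun x y => by simp⟩, fun c x => by simp⟩,
    ⟨fun x => ⟨_, hE.mem _, rfl⟩, fun y hy => ?_, fun y hy z hz x => ?_, fun x => ?_,
      fun x => ?_⟩⟩
  · change α (E (α.symm y)) = y
    rw [hE.apply_of_mem _ (hmem hy), StarAlgEquiv.apply_symm_apply]
  · change α (E (α.symm (y * x * z))) = y * α (E (α.symm x)) * z
    rw [map_mul α.symm, map_mul α.symm, hE.bimodule _ (hmem hy) _ (hmem hz), map_mul α, map_mul α,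
      StarAlgEquiv.apply_symm_apply, StarAlgEquiv.apply_symm_apply]
  · change ‖α (E (α.symm x))‖ ≤ ‖x‖
    rw [hnorm]
    exact (hE.norm_le _).trans_eq (hnorm' x)
  · change groupTrace Γ (α (E (α.symm x))) = _
    rw [htr, hE.trace_apply, htr']

theorem isCondExp_condExp {A : StarSubalgebra ℂ (VN Γ)}
    (h : ∃ E, IsCondExp (groupTrace Γ) A E) :
    IsCondExp (groupTrace Γ) A (condExp (groupTrace Γ) A) := by
  rw [condExp, dif_pos h]
  exact h.choose_spec

end ConditionalExpectation
/-! ## The asymptotic homomorphism property -/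

section Restriction

variable {Γ : Type*}

open Classical in
theorem memlp_restrict (s : Set Γ) (ξ : EllTwo Γ) :
    Memℓp (fun g => if g ∈ s then ξ g else 0) 2 := by
  rw [memℓp_gen_iff (by norm_num)]
  have := summable_norm_sq ξ
  refine Summable.of_nonneg_of_le (fun g => by positivity) (fun g => ?_) this
  by_cases hg : g ∈ s <;> simp [hg]

open Classical in
/-- The restriction of vectors of `ℓ²(Γ)` to a subset of `Γ`. -/
noncomputable def restrictOp (s : Set Γ) : EllTwo Γ →L[ℂ] EllTwo Γ :=
  LinearMap.mkContinuous
    { toFun := fun ξ => ⟨fun g => if g ∈ s then ξ g else 0, memlp_restrict s ξ⟩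
      map_add' := fun ξ η => by
        ext g
        change (if g ∈ s then ξ g + η g else 0) =
          (if g ∈ s then ξ g else 0) + (if g ∈ s then η g else 0)
        split_ifs <;> simp
      map_smul' := fun c ξ => by
        ext g
        change (if g ∈ s then c * ξ g else 0) = c * (if g ∈ s then ξ g else 0)
        split_ifs <;> simp } 1 fun ξ => by
    rw [one_mul]
    refine lp.norm_mono (by norm_num) fun g => ?_
    change ‖(if g ∈ s then ξ g else 0)‖ ≤ _
    split_ifs <;> simp

open Classical in
theorem restrictOp_apply (s : Set Γ) (ξ : EllTwo Γ) (g : Γ) :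
    restrictOp s ξ g = if g ∈ s then ξ g else 0 := rfl

theorem norm_restrictOp_le (s : Set Γ) : ‖restrictOp s‖ ≤ 1 :=
  LinearMap.mkContinuous_norm_le _ zero_le_one _

theorem norm_sq_restrictOp (s : Set Γ) (ξ : EllTwo Γ) :
    ‖restrictOp s ξ‖ ^ 2 = ∑' g : s, ‖ξ g‖ ^ 2 := by
  classical
  rw [norm_sq_eq_tsum, tsum_subtype s fun g => ‖ξ g‖ ^ 2]
  refine tsum_congr fun g => ?_
  rw [restrictOp_apply]
  by_cases hg : g ∈ s <;> simp [hg]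

theorem norm_sq_eq_restrictOp_add (s : Set Γ) (ξ : EllTwo Γ) :
    ‖ξ‖ ^ 2 = ‖ξ - restrictOp s ξ‖ ^ 2 + ‖restrictOp s ξ‖ ^ 2 := by
  classical
  rw [norm_sq_eq_tsum, norm_sq_eq_tsum, norm_sq_eq_tsum,
    ← (summable_norm_sq _).tsum_add (summable_norm_sq _)]
  refine tsum_congr fun g => ?_
  rw [lp.coeFn_sub, Pi.sub_apply, restrictOp_apply]
  by_cases hg : g ∈ s <;> simp [hg]

end Restriction

section AsymptoticHomomorphism

variable {Γ : Type*} [Group Γ]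

/-- The squared norm at step `k` is the sum of `|x δ_1|²` over `⟨a⟩ h⁻¹ a^{-k}`. These sets are
disjoint for different `k`, so the squared norms are the terms of a convergent series. -/
theorem tendsto_restrictOp_delta {a : Γ} (ha : IsMalnormalElement a)
    {x : EllTwo Γ →L[ℂ] EllTwo Γ} (hx : x ∈ (groupVN Γ).toStarSubalgebra) {h : Γ}
    (hh : h ∉ Subgroup.zpowers a) :
    Filter.Tendsto
      (fun k : ℕ => restrictOp (Subgroup.zpowers a : Set Γ) (x (leftRegular (a ^ k) (delta h))))
      Filter.atTop (nhds 0) := by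
  have hinj : Function.Injective
      (fun p : ℕ × (Subgroup.zpowers a : Set Γ) => (p.2 : Γ) * (a ^ p.1 * h)⁻¹) := by
    rintro ⟨k, g, hg⟩ ⟨l, g', hg'⟩ hkl
    simp only at hkl
    have hk : k = l := by
      by_contra hne
      refine ha h⁻¹ (by simpa using hh) ((l : ℤ) - k)
        (sub_ne_zero.mpr (by exact_mod_cast Ne.symm hne)) ?_
      have : h⁻¹ * a ^ ((l : ℤ) - k) * h⁻¹⁻¹ = g⁻¹ * g' := by
        have h1 : g' = g * (a ^ k * h)⁻¹ * (a ^ l * h) := eq_mul_of_mul_inv_eq hkl.symm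
        rw [h1, sub_eq_neg_add, zpow_add, zpow_neg]
        simp [mul_assoc]
      rw [this]
      exact mul_mem (inv_mem hg) hg'
    subst hk
    rw [mul_left_inj] at hkl
    subst hkl
    rfl
  have hsum := (((summable_norm_sq (x (delta 1))).comp_injective hinj).prod).tendsto_atTop_zero
  rw [tendsto_zero_iff_norm_tendsto_zero]
  have hsq : Filter.Tendsto (fun k : ℕ => ‖restrictOp (Subgroup.zpowers a : Set Γ)
      (x (leftRegular (a ^ k) (delta h)))‖ ^ 2) Filter.atTop (nhds 0) := by
    refine hsum.congr fun k => ?_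
    rw [norm_sq_restrictOp]
    refine tsum_congr fun g => ?_
    rw [leftRegular_delta, apply_delta_apply hx]
    rfl
  have := hsq.sqrt
  simpa [Real.sqrt_sq (norm_nonneg _)] using this

theorem tendsto_zero_of_delta {Γ : Type*} {T : ℕ → EllTwo Γ →L[ℂ] EllTwo Γ} {C : ℝ}
    (hC : ∀ k, ‖T k‖ ≤ C) {η : EllTwo Γ}
    (h : ∀ g, η g ≠ 0 → Filter.Tendsto (fun k => T k (delta g)) Filter.atTop (nhds 0)) :
    Filter.Tendsto (fun k => T k η) Filter.atTop (nhds 0) := by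
  have hC0 : 0 ≤ C := (norm_nonneg _).trans (hC 0)
  have hfin : ∀ s : Finset Γ, Filter.Tendsto (fun k => T k (∑ g ∈ s, η g • delta g))
      Filter.atTop (nhds 0) := fun s => by
    simp only [map_sum, map_smul]
    rw [← Finset.sum_const_zero (s := s)]
    refine tendsto_finsetSum _ fun g _ => ?_
    by_cases hg : η g = 0
    · simp [hg]
    · rw [← smul_zero (η g)]
      exact (h g hg).const_smul (η g)
  rw [Metric.tendsto_atTop]
  intro ε hε
  have hη : Filter.Tendsto (fun s : Finset Γ => ∑ g ∈ s, η g • delta g) Filter.atTop (nhds η) := by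
    have := hasSum_smul_delta η
    rwa [HasSum, SummationFilter.unconditional_filter] at this
  obtain ⟨s, hs⟩ := (hη.eventually (Metric.ball_mem_nhds η
    (by positivity : 0 < ε / (2 * (C + 1))))).exists
  obtain ⟨N, hN⟩ := Metric.tendsto_atTop.mp (hfin s) (ε / 2) (by positivity)
  refine ⟨N, fun k hk => ?_⟩
  have h1 := hN k hk
  rw [dist_zero_right] at h1 ⊢
  rw [dist_comm, dist_eq_norm] at hs
  set ζ := ∑ g ∈ s, η g • delta g
  calc ‖T k η‖ = ‖T k (η - ζ) + T k ζ‖ := by rw [← map_add, sub_add_cancel]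
    _ ≤ C * ‖η - ζ‖ + ‖T k ζ‖ :=
        (norm_add_le _ _).trans (by gcongr; exact (T k).le_of_opNorm_le (hC k) _)
    _ < (C + 1) * (ε / (2 * (C + 1))) + ε / 2 := by
        refine add_lt_add_of_le_of_lt ?_ h1
        gcongr
        linarith
    _ = ε := by field_simp; ring

theorem tendsto_restrictOp_of_eq_zero {a : Γ} (ha : IsMalnormalElement a)
    {x : EllTwo Γ →L[ℂ] EllTwo Γ} (hx : x ∈ (groupVN Γ).toStarSubalgebra) {η : EllTwo Γ}
    (hη : ∀ g ∈ Subgroup.zpowers a, η g = 0) :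
    Filter.Tendsto
      (fun k : ℕ => restrictOp (Subgroup.zpowers a : Set Γ) (x (leftRegular (a ^ k) η)))
      Filter.atTop (nhds 0) := by
  refine tendsto_zero_of_delta (C := ‖x‖)
    (T := fun k => restrictOp (Subgroup.zpowers a : Set Γ) * (x * leftRegular (a ^ k)))
    (fun k => ?_) (fun g hg => tendsto_restrictOp_delta ha hx fun h => hg (hη g h))
  refine ContinuousLinearMap.opNorm_le_bound _ (norm_nonneg _) fun ζ => ?_
  refine ((restrictOp _).le_of_opNorm_le (norm_restrictOp_le _) _).trans ?_
  rw [one_mul, ← norm_leftRegular_apply (a ^ k) ζ]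
  exact x.le_opNorm _

/-- The unitary `λ(g)` as an element of `VN(Γ)`. -/
noncomputable def groupElement (g : Γ) : VN Γ := ⟨leftRegular g, leftRegular_mem_groupVN g⟩

theorem groupElement_pow_mem (a : Γ) (k : ℕ) : groupElement (a ^ k) ∈ elementSubalgebra a := by
  have := leftRegular_zpow_mem_elementSubalgebra a k
  simp only [zpow_natCast] at this
  exact this

/-- The coefficient at `a^n` is the trace of `λ(a^{-n}) x`, which `E` preserves by the bimodule
property; off `⟨a⟩` the coefficients of `E x` vanish because it commutes with `λ(a)`. -/
theorem IsCondExp.apply_delta_one {a : Γ} (ha : IsMalnormalElement a) {E : VN Γ →ₗ[ℂ] VN Γ}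
    (hE : IsCondExp (groupTrace Γ) (elementSubalgebra a) E) (x : VN Γ) :
    (E x).1 (delta 1) = restrictOp (Subgroup.zpowers a : Set Γ) (x.1 (delta 1)) := by
  classical
  ext g
  rw [restrictOp_apply]
  split_ifs with hg
  · obtain ⟨n, rfl⟩ := Subgroup.mem_zpowers_iff.mp hg
    have h1 := hE.bimodule _ (leftRegular_zpow_mem_elementSubalgebra a (-n)) 1 (one_mem _) x
    have h2 := hE.trace_apply (⟨leftRegular (a ^ (-n)), leftRegular_mem_groupVN _⟩ * x * 1)
    rw [h1, mul_one, mul_one, groupTrace_eq_coeff, groupTrace_eq_coeff] at h2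
    change leftRegular (a ^ (-n)) ((E x).1 (delta 1)) 1 =
      leftRegular (a ^ (-n)) (x.1 (delta 1)) 1 at h2
    simpa using h2
  · exact coeff_eq_zero_of_commute ha (E x).2 (commute_of_mem_elementSubalgebra (hE.mem x)) hg

theorem IsCondExp.norm_sq_apply_delta_one {a : Γ} (ha : IsMalnormalElement a)
    {E : VN Γ →ₗ[ℂ] VN Γ} (hE : IsCondExp (groupTrace Γ) (elementSubalgebra a) E) (x : VN Γ) :
    twoNorm (groupTrace Γ) x ^ 2 =
      twoNorm (groupTrace Γ) (x - E x) ^ 2 + twoNorm (groupTrace Γ) (E x) ^ 2 := by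
  have := norm_sq_eq_restrictOp_add (Subgroup.zpowers a : Set Γ) (x.1 (delta 1))
  rwa [← hE.apply_delta_one ha, ← twoNorm_eq, ← twoNorm_eq, ← sub_apply,
    ← AddSubgroupClass.coe_sub, ← twoNorm_eq] at this

theorem IsCondExp.twoNorm_star {a : Γ} (ha : IsMalnormalElement a)
    {E : VN Γ →ₗ[ℂ] VN Γ} (hE : IsCondExp (groupTrace Γ) (elementSubalgebra a) E) (x : VN Γ) :
    twoNorm (groupTrace Γ) (E (star x)) = twoNorm (groupTrace Γ) (E x) := by
  classical
  rw [twoNorm_eq, twoNorm_eq]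
  refine norm_eq_of_norm_apply_perm (Equiv.inv Γ) fun g => ?_
  rw [hE.apply_delta_one ha, hE.apply_delta_one ha, restrictOp_apply, restrictOp_apply]
  have : (star x).1 (delta 1) g = star (x.1 (delta 1) g⁻¹) := star_apply_delta_one_apply x.2 g
  rw [this]
  by_cases hg : g ∈ Subgroup.zpowers a <;> simp [hg]

theorem twoNorm_nonneg (x : VN Γ) : 0 ≤ twoNorm (groupTrace Γ) x := Real.sqrt_nonneg _

theorem twoNorm_mul_le (x y : VN Γ) :
    twoNorm (groupTrace Γ) (x * y) ≤ ‖x‖ * twoNorm (groupTrace Γ) y := by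
  rw [twoNorm_eq, twoNorm_eq]
  exact x.1.le_opNorm _

theorem twoNorm_le_norm (x : VN Γ) : twoNorm (groupTrace Γ) x ≤ ‖x‖ := by
  rw [twoNorm_eq]
  exact (x.1.le_opNorm _).trans_eq (by rw [norm_delta, mul_one]; rfl)

theorem twoNorm_add_le (x y : VN Γ) :
    twoNorm (groupTrace Γ) (x + y) ≤ twoNorm (groupTrace Γ) x + twoNorm (groupTrace Γ) y := by
  rw [twoNorm_eq, twoNorm_eq, twoNorm_eq]
  exact norm_add_le (x.1 (delta 1)) (y.1 (delta 1))

theorem IsCondExp.twoNorm_sub_le {a : Γ} (ha : IsMalnormalElement a)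
    {E : VN Γ →ₗ[ℂ] VN Γ} (hE : IsCondExp (groupTrace Γ) (elementSubalgebra a) E) (x : VN Γ) :
    twoNorm (groupTrace Γ) (x - E x) ≤ twoNorm (groupTrace Γ) x := by
  have := hE.norm_sq_apply_delta_one ha x
  exact (pow_le_pow_iff_left₀ (twoNorm_nonneg _) (twoNorm_nonneg _) two_ne_zero).mp
    (by nlinarith [sq_nonneg (twoNorm (groupTrace Γ) (E x))])

/-- The asymptotic homomorphism property of the conditional expectation. -/
theorem IsCondExp.tendsto_twoNorm {a : Γ} (ha : IsMalnormalElement a)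
    {E : VN Γ →ₗ[ℂ] VN Γ} (hE : IsCondExp (groupTrace Γ) (elementSubalgebra a) E) (x y : VN Γ) :
    Filter.Tendsto (fun k : ℕ => twoNorm (groupTrace Γ)
      (E (x * groupElement (a ^ k) * y) - E x * groupElement (a ^ k) * E y))
      Filter.atTop (nhds 0) := by
  classical
  have hη : ∀ g ∈ Subgroup.zpowers a, (y - E y).1 (delta 1) g = 0 := fun g hg => by
    change (y.1 (delta 1) - (E y).1 (delta 1) : EllTwo Γ) g = 0
    rw [hE.apply_delta_one ha, lp.coeFn_sub, Pi.sub_apply, restrictOp_apply]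
    simp [hg]
  have h0 := (tendsto_restrictOp_of_eq_zero ha x.2 hη).norm
  rw [norm_zero] at h0
  refine h0.congr fun k => ?_
  -- By the bimodule property `y` may be replaced by `y - E y`, whose coefficients vanish on `⟨a⟩`.
  have h1 : E (x * groupElement (a ^ k) * y) - E x * groupElement (a ^ k) * E y =
      E (x * groupElement (a ^ k) * (y - E y)) := by
    have := hE.bimodule 1 (one_mem _) _ (mul_mem (groupElement_pow_mem a k) (hE.mem y)) x
    rw [one_mul, one_mul] at this
    rw [mul_sub, map_sub, mul_assoc (E x), ← this, mul_assoc x _ (E y)]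
  rw [h1, twoNorm_eq, hE.apply_delta_one ha]
  rfl

/-- The subalgebra generated by a malnormal element is strongly singular. -/
theorem isStronglySingular_elementSubalgebra {a : Γ} (ha : IsMalnormalElement a) :
    IsStronglySingular (groupTrace Γ) (elementSubalgebra a) := by
  intro u
  have hE := isCondExp_condExp (exists_isCondExp_elementSubalgebra ha)
  have hF := isCondExp_condExp (hE.unitaryConj u)
  set E := condExp (groupTrace Γ) (elementSubalgebra a)
  set F := condExp (groupTrace Γ) (unitaryConj u (elementSubalgebra a))
  set S := inftyTwoNorm (groupTrace Γ) (F - E) with hS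
  have hle : ∀ x : VN Γ, ‖x‖ ≤ 1 → twoNorm (groupTrace Γ) ((F - E) x) ≤ S := fun x hx => by
    -- Both expectations are contractive, so `2` bounds the set and its supremum is not a default
    -- value.
    refine le_csSup ⟨2, ?_⟩ ⟨x, hx, rfl⟩
    rintro _ ⟨y, hy, rfl⟩
    refine (twoNorm_le_norm _).trans ?_
    rw [LinearMap.sub_apply]
    linarith [norm_sub_le (F y) (E y), hF.norm_le y, hE.norm_le y]
  have hS0 : 0 ≤ S := (twoNorm_nonneg _).trans (hle 0 (by simp))
  have hisom : ∀ w ∈ unitary (VN Γ), ∀ ξ, ‖w.1 ξ‖ = ‖ξ‖ := fun w hw ξ =>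
    ContinuousLinearMap.norm_map_of_mem_unitary
      (⟨congrArg Subtype.val hw.1, congrArg Subtype.val hw.2⟩ :
        w.1 ∈ unitary (EllTwo Γ →L[ℂ] EllTwo Γ)) ξ
  have hnorm : ∀ w ∈ unitary (VN Γ), ‖w‖ ≤ 1 := fun w hw =>
    ContinuousLinearMap.opNorm_le_bound _ zero_le_one fun ξ => by
      rw [one_mul]
      exact (hisom w hw ξ).le
  have htwo : ∀ w ∈ unitary (VN Γ), twoNorm (groupTrace Γ) w = 1 := fun w hw => by
    rw [twoNorm_eq, hisom w hw, norm_delta]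
  have hg : ∀ g : Γ, groupElement g ∈ unitary (VN Γ) := fun g => by
    constructor <;> refine Subtype.ext ?_
    · change star (leftRegular g) * leftRegular g = 1
      rw [star_leftRegular, ← leftRegular_mul, inv_mul_cancel, leftRegular_one]
    · change leftRegular g * star (leftRegular g) = 1
      rw [star_leftRegular, ← leftRegular_mul, mul_inv_cancel, leftRegular_one]
  have hlim := hE.tendsto_twoNorm ha (u : VN Γ) (star (u : VN Γ))
  set e : ℕ → ℝ := fun k => twoNorm (groupTrace Γ)
    (E (u * groupElement (a ^ k) * star (u : VN Γ)) -
      E u * groupElement (a ^ k) * E (star (u : VN Γ)))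
  set c := twoNorm (groupTrace Γ) (E (u : VN Γ)) with hc
  -- The test unitary `w = u λ(a^k) u*` is fixed by `F`, so by Pythagoras `‖(F - E)w‖₂² = 1 - ‖E
  -- w‖₂²`. The main part `E(u) λ(a^k) E(u*)` of `E w` has trace norm at most `‖E(u*)‖₂ = c`. In the
  -- limit `1 - c² = ‖u - E u‖₂²`.
  have hbound : ∀ k, 1 - (c + e k) ^ 2 ≤ S ^ 2 := fun k => by
    set w : VN Γ := u * groupElement (a ^ k) * star (u : VN Γ) with hw
    have hwU : w ∈ unitary (VN Γ) := mul_mem (mul_mem u.2 (hg _)) (Unitary.star_mem u.2)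
    have hFw : F w = w := hF.apply_of_mem _
      ⟨_, groupElement_pow_mem a k, Unitary.conjStarAlgAut_apply (S := ℂ) u (groupElement (a ^ k))⟩
    have h1 := hle w (hnorm w hwU)
    rw [LinearMap.sub_apply, hFw] at h1
    have h2 := hE.norm_sq_apply_delta_one ha w
    rw [htwo w hwU] at h2
    have h3 : twoNorm (groupTrace Γ) (E w) ≤ c + e k := by
      have h4 : E w = E u * groupElement (a ^ k) * E (star (u : VN Γ)) +
          (E w - E u * groupElement (a ^ k) * E (star (u : VN Γ))) := by abel
      rw [h4]
      refine (twoNorm_add_le _ _).trans ?_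
      refine add_le_add_left ?_ _
      refine (twoNorm_mul_le _ _).trans ?_
      rw [hE.twoNorm_star ha, ← hc]
      refine mul_le_of_le_one_left (twoNorm_nonneg _) ?_
      refine (norm_mul_le _ _).trans ?_
      exact mul_le_one₀ ((hE.norm_le _).trans (hnorm _ u.2)) (norm_nonneg _) (hnorm _ (hg _))
    have h5 := pow_le_pow_left₀ (twoNorm_nonneg _) h1 2
    have h6 := pow_le_pow_left₀ (twoNorm_nonneg _) h3 2
    linarith
  have hfinal : 1 - (c + 0) ^ 2 ≤ S ^ 2 :=
    le_of_tendsto (((hlim.const_add c).pow 2).const_sub 1) (Filter.Eventually.of_forall hbound)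
  have h7 := hE.norm_sq_apply_delta_one ha (u : VN Γ)
  rw [htwo _ u.2] at h7
  rw [one_mul]
  refine (pow_le_pow_iff_left₀ (twoNorm_nonneg _) hS0 two_ne_zero).mp ?_
  rw [add_zero] at hfinal
  linarith

end AsymptoticHomomorphism

/-! ## The Popa invariant -/

section Popa

variable {Γ : Type*} [Group Γ]

theorem VN.eq_zero_of_star_mul_self {x : VN Γ} (h : star x * x = 0) : x = 0 :=
  Subtype.ext (CStarRing.star_mul_self_eq_zero_iff (x.1) |>.mp (congrArg Subtype.val h))

variable {A : StarSubalgebra ℂ (VN Γ)} {v : VN Γ}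

theorem IsOrthogonalPartialIsometry.mul_initial (hv : IsOrthogonalPartialIsometry A v) :
    v * (star v * v) = v := by
  have hp := hv.isStarProjection_initial.isIdempotentElem.eq
  have : v - v * (star v * v) = 0 := VN.eq_zero_of_star_mul_self <| by
    rw [star_sub, star_mul, star_mul, star_star, mul_sub, sub_mul, sub_mul, ← mul_assoc (star v) v,
      mul_assoc (star v * v) (star v) v, hp, mul_assoc (star v * v) (star v),
      ← mul_assoc (star v) v, hp, hp]
    simp
  exact (sub_eq_zero.mp this).symm

theorem IsOrthogonalPartialIsometry.norm_le_one (hv : IsOrthogonalPartialIsometry A v) :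
    ‖v‖ ≤ 1 := by
  have h1 : ‖v.1‖ * ‖v.1‖ = ‖star v.1 * v.1‖ := CStarRing.norm_star_mul_self.symm
  have h2 : v.1 * (star v.1 * v.1) = v.1 := congrArg Subtype.val hv.mul_initial
  have h3 : star v.1 * v.1 * (star v.1 * v.1) = star v.1 * v.1 := by rw [mul_assoc, h2]
  have h4 : ‖star v.1 * v.1‖ * ‖star v.1 * v.1‖ = ‖star v.1 * v.1‖ := by
    rw [← CStarRing.norm_star_mul_self, star_mul, star_star, h3]
  change ‖v.1‖ ≤ 1
  rw [← h1] at h4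
  by_contra! hlt
  nlinarith [mul_pos (zero_lt_one.trans hlt) (zero_lt_one.trans hlt),
    mul_lt_mul'' hlt hlt zero_le_one zero_le_one]

theorem IsOrthogonalPartialIsometry.twoNorm_final (hv : IsOrthogonalPartialIsometry A v) :
    twoNorm (groupTrace Γ) (v * star v) = twoNorm (groupTrace Γ) (star v * v) := by
  rw [twoNorm, twoNorm, hv.isStarProjection_initial.isSelfAdjoint.star_eq,
    hv.isStarProjection_initial.isIdempotentElem.eq,
    hv.isStarProjection_final.isSelfAdjoint.star_eq,
    hv.isStarProjection_final.isIdempotentElem.eq, groupTrace_mul_comm]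

theorem IsOrthogonalPartialIsometry.twoNorm_pos (hv : IsOrthogonalPartialIsometry A v) :
    0 < twoNorm (groupTrace Γ) (star v * v) := by
  refine (twoNorm_nonneg _).lt_of_ne' fun h => hv.ne_zero ?_
  rw [twoNorm_eq, norm_eq_zero] at h
  refine VN.eq_zero_of_star_mul_self (Subtype.ext ?_)
  exact groupVN_ext (star v * v).2 (zero_mem _) h

theorem IsOrthogonalPartialIsometry.norm_conj_le_one (hv : IsOrthogonalPartialIsometry A v)
    {w : VN Γ} (hw : ‖w‖ ≤ 1) : ‖v * w * star v‖ ≤ 1 := by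
  have hv1 : ‖v.1‖ ≤ 1 := hv.norm_le_one
  have hw1 : ‖w.1‖ ≤ 1 := hw
  change ‖v.1 * w.1 * star v.1‖ ≤ 1
  refine (norm_mul_le _ _).trans ?_
  rw [norm_star]
  exact mul_le_one₀ ((norm_mul_le _ _).trans (mul_le_one₀ hv1 (norm_nonneg _) hw1))
    (norm_nonneg _) hv1

theorem IsOrthogonalPartialIsometry.twoNorm_conj (hv : IsOrthogonalPartialIsometry A v)
    {w : VN Γ} (hw : star w * w = 1) (hc : star v * v * w = w * (star v * v)) :
    twoNorm (groupTrace Γ) (v * w * star v) = twoNorm (groupTrace Γ) (star v * v) := by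
  have hsq : star (v * w * star v) * (v * w * star v) = v * star v := by
    rw [star_mul, star_mul, star_star]
    calc v * (star w * star v) * (v * w * star v)
        = v * (star w * ((star v * v) * w)) * star v := by simp only [mul_assoc]
      _ = v * ((star w * w) * (star v * v)) * star v := by rw [hc]; simp only [mul_assoc]
      _ = v * star v := by rw [hw, one_mul, hv.mul_initial]
  rw [twoNorm, twoNorm, hsq, hv.isStarProjection_initial.isSelfAdjoint.star_eq,
    hv.isStarProjection_initial.isIdempotentElem.eq, groupTrace_mul_comm]

/-- Since `vyv* = vyv* · vv*`, its trace norm is at most `‖vv*‖₂ = ‖v*v‖₂`, and subtracting the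
expectation does not increase the trace norm. -/
theorem IsOrthogonalPartialIsometry.popaDist_le {a : Γ} (ha : IsMalnormalElement a)
    (hv : IsOrthogonalPartialIsometry (M := VN Γ) (elementSubalgebra a) v) :
    popaDist (groupTrace Γ) (elementSubalgebra a) v ≤ twoNorm (groupTrace Γ) (star v * v) := by
  have hE := isCondExp_condExp (exists_isCondExp_elementSubalgebra ha)
  refine csSup_le ⟨_, 0, zero_mem _, by simp, rfl⟩ ?_
  rintro _ ⟨y, -, hy, rfl⟩
  refine (hE.twoNorm_sub_le ha _).trans ?_
  have h1 : star v * (v * star v) = star v := by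
    have := congrArg star hv.mul_initial
    rwa [star_mul, star_mul, star_star, mul_assoc] at this
  have h2 : v * y * star v = v * y * star v * (v * star v) := by
    rw [mul_assoc (v * y), h1]
  rw [← hv.twoNorm_final]
  calc _ = twoNorm (groupTrace Γ) (v * y * star v * (v * star v)) := congrArg _ h2
    _ ≤ _ := (twoNorm_mul_le _ _).trans (mul_le_of_le_one_left (twoNorm_nonneg _) hy)

theorem IsOrthogonalPartialIsometry.le_popaDist {a : Γ} (ha : IsMalnormalElement a)
    (hv : IsOrthogonalPartialIsometry (M := VN Γ) (elementSubalgebra a) v) :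
    twoNorm (groupTrace Γ) (star v * v) ≤ popaDist (groupTrace Γ) (elementSubalgebra a) v := by
  have hE := isCondExp_condExp (exists_isCondExp_elementSubalgebra ha)
  rw [popaDist]
  set E := condExp (groupTrace Γ) (elementSubalgebra a)
  set D := sSup {r : ℝ | ∃ y ∈ elementSubalgebra a, ‖v * y * star v‖ ≤ 1 ∧
    r = twoNorm (groupTrace Γ) (v * y * star v - E (v * y * star v))}
  -- With `v = (vv*) v (v*v)`, the bimodule property and commutativity of `A` put the product of the
  -- orthogonal projections next to `E v`, giving `E v = 0`.
  have hcomm : ∀ x ∈ elementSubalgebra a, ∀ y ∈ elementSubalgebra a, x * y = y * x :=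
    (isMasa_elementSubalgebra ha).prop
  have hEv : E v = 0 := by
    have h1 : v * star v * v * (star v * v) = v := by
      rw [mul_assoc v, hv.mul_initial, hv.mul_initial]
    have h2 := hE.bimodule _ hv.final_mem _ hv.initial_mem v
    rw [h1, hcomm _ hv.final_mem _ (hE.mem v), mul_assoc, hv.orthogonal, mul_zero] at h2
    exact h2
  have hle : ∀ y ∈ elementSubalgebra a, ‖v * y * star v‖ ≤ 1 →
      twoNorm (groupTrace Γ) (v * y * star v - E (v * y * star v)) ≤ D := fun y hy hn => by
    refine le_csSup ⟨2, ?_⟩ ⟨y, hy, hn, rfl⟩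
    rintro _ ⟨z, -, hz, rfl⟩
    refine (twoNorm_le_norm _).trans ?_
    linarith [norm_sub_le (v * z * star v) (E (v * z * star v)), hE.norm_le (v * z * star v)]
  have hD0 : 0 ≤ D := (twoNorm_nonneg _).trans (hle 0 (zero_mem _) (by simp))
  have hlim := hE.tendsto_twoNorm ha v (star v)
  simp only [hEv, zero_mul, sub_zero] at hlim
  -- The test elements are `v λ(a^k) v*`: each has trace norm `‖v*v‖₂`, and their expectations tend
  -- to `0` because `E v = 0`.
  have hbound : ∀ k : ℕ, twoNorm (groupTrace Γ) (star v * v) ^ 2 - twoNorm (groupTrace Γ)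
      (E (v * groupElement (a ^ k) * star v)) ^ 2 ≤ D ^ 2 := fun k => by
    set w : VN Γ := groupElement (a ^ k) with hw
    have hww : star w * w = 1 := Subtype.ext <| by
      change star (leftRegular (a ^ k)) * leftRegular (a ^ k) = 1
      rw [star_leftRegular, ← leftRegular_mul, inv_mul_cancel, leftRegular_one]
    have hwA : w ∈ elementSubalgebra a := groupElement_pow_mem a k
    have hnw : ‖w‖ ≤ 1 := ContinuousLinearMap.opNorm_le_bound _ zero_le_one fun ξ => by
      rw [one_mul]
      exact (norm_leftRegular_apply _ _).le
    have hnorm : ‖v * w * star v‖ ≤ 1 := hv.norm_conj_le_one hnw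
    have h2 := hv.twoNorm_conj hww (hcomm _ hv.initial_mem _ hwA)
    have h3 := hE.norm_sq_apply_delta_one ha (v * w * star v)
    have h4 := pow_le_pow_left₀ (twoNorm_nonneg _) (hle w hwA hnorm) 2
    rw [h2] at h3
    linarith
  have hfinal := le_of_tendsto ((hlim.pow 2).const_sub (twoNorm (groupTrace Γ) (star v * v) ^ 2))
    (Filter.Eventually.of_forall hbound)
  refine (pow_le_pow_iff_left₀ (twoNorm_nonneg _) hD0 two_ne_zero).mp ?_
  simpa using hfinal

/-- An admissible `v` bounds the constants above by `1`; without one, every real `c` would qualify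
and the supremum would be the default value `0`. -/
theorem popaInvariant_elementSubalgebra {a : Γ} (ha : IsMalnormalElement a)
    (hv : ∃ v : VN Γ, IsOrthogonalPartialIsometry (M := VN Γ) (elementSubalgebra a) v) :
    popaInvariant (groupTrace Γ) (elementSubalgebra a) = 1 := by
  refine IsGreatest.csSup_eq ⟨fun v hv => ?_, fun c hc => ?_⟩
  · rw [one_mul]
    exact hv.le_popaDist ha
  · obtain ⟨v, hv⟩ := hv
    have h1 := (hc v hv).trans (hv.popaDist_le ha)
    exact (mul_le_iff_le_one_left hv.twoNorm_pos).mp h1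

end Popa
/-! ## Symmetries from injective self-adjoint operators -/

section SignOperator

variable {H : Type*} [NormedAddCommGroup H] [InnerProductSpace ℂ H] [CompleteSpace H]

theorem denseRange_of_isSelfAdjoint {x : H →L[ℂ] H} (hx : IsSelfAdjoint x)
    (hinj : ∀ ξ, x ξ = 0 → ξ = 0) : DenseRange x := by
  have h1 : (LinearMap.range (x : H →ₗ[ℂ] H)).topologicalClosure = ⊤ := by
    rw [Submodule.topologicalClosure_eq_top_iff, eq_bot_iff]
    intro ξ hξ
    refine hinj ξ (ext_inner_left ℂ fun ζ => ?_)
    rw [inner_zero_right, ← hx.star_eq, ContinuousLinearMap.star_eq_adjoint,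
      ContinuousLinearMap.adjoint_inner_right]
    exact (Submodule.mem_orthogonal _ _).mp hξ _ ⟨ζ, rfl⟩
  rw [DenseRange, dense_iff_closure_eq]
  exact congrArg (SetLike.coe) h1

/-- The sign of an injective self-adjoint operator: a self-adjoint unitary commuting with everything
that commutes with `x` and anticommuting with everything that anticommutes with `x`. -/
theorem exists_sign {x : H →L[ℂ] H} (hx : IsSelfAdjoint x) (hinj : ∀ ξ, x ξ = 0 → ξ = 0) :
    ∃ w : H →L[ℂ] H, IsSelfAdjoint w ∧ w * w = 1 ∧ (∀ y, Commute y x → Commute y w) ∧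
      ∀ s, s * x = -(x * s) → s * w = -(w * s) := by
  have hdense := denseRange_of_isSelfAdjoint hx hinj
  have hcancel : ∀ {y z : H →L[ℂ] H}, y * x = z * x → y = z := fun {y z} h => by
    refine DFunLike.coe_injective (hdense.equalizer y.continuous z.continuous ?_)
    funext ξ
    exact DFunLike.congr_fun h ξ
  have hcancel' : ∀ {y z : H →L[ℂ] H}, x * y = x * z → y = z := fun {y z} h => by
    ext1 ξ
    refine sub_eq_zero.mp (hinj _ ?_)
    rw [map_sub, sub_eq_zero]
    exact DFunLike.congr_fun h ξ
  have hnn : 0 ≤ x * x := by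
    have := star_mul_self_nonneg x
    rwa [hx.star_eq] at this
  set m := CFC.sqrt (x * x) with hm
  have hmm : m * m = x * x := CFC.sqrt_mul_sqrt_self _ hnn
  have hmsa : IsSelfAdjoint m := (CFC.sqrt_nonneg (x * x)).isSelfAdjoint
  have hmc : ∀ y, Commute y (x * x) → Commute y m := fun y hy =>
    (Commute.cfcₙ_nnreal hy.symm _).symm
  have hnorm : ∀ ξ, ‖m ξ‖ ≤ 1 * ‖x ξ‖ := fun ξ => by
    have key : ∀ z : H →L[ℂ] H, IsSelfAdjoint z → ‖z ξ‖ ^ 2 = (inner ℂ ξ ((z * z) ξ)).re :=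
      fun z hz => by
        have h := ContinuousLinearMap.adjoint_inner_right z ξ (z ξ)
        rw [← ContinuousLinearMap.star_eq_adjoint, hz.star_eq, inner_self_eq_norm_sq_to_K] at h
        rw [mul_apply_eq_comp, h]
        norm_cast
    rw [one_mul]
    refine (pow_le_pow_iff_left₀ (norm_nonneg _) (norm_nonneg _) two_ne_zero).mp ?_
    rw [key m hmsa, key x hx, hmm]
  -- On the dense range of `x`, `w` sends `xξ` to `|x|ξ`; this is well defined and bounded because
  -- `‖|x|ξ‖ = ‖xξ‖`.
  set w : H →L[ℂ] H := (m : H →ₗ[ℂ] H).extendOfNorm (x : H →ₗ[ℂ] H) with hw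
  have hwx : w * x = m := by
    ext1 ξ
    exact LinearMap.extendOfNorm_eq (f := (m : H →ₗ[ℂ] H)) (e := (x : H →ₗ[ℂ] H)) hdense
      ⟨1, hnorm⟩ ξ
  have hxm : Commute x m := hmc x ((Commute.refl x).mul_right (Commute.refl x))
  have hwm : w * m = x := hcancel <| by rw [mul_assoc, ← hxm.eq, ← mul_assoc, hwx, hmm]
  refine ⟨w, ?_, ?_, fun y hy => ?_, fun s hs => ?_⟩
  · have h1 : x * star w = m := by
      have := congrArg star hwx
      rwa [star_mul, hx.star_eq, hmsa.star_eq] at this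
    refine hcancel (hcancel' ?_)
    rw [← mul_assoc, h1, hwx, hxm.eq]
  · refine hcancel ?_
    rw [mul_assoc, hwx, hwm, one_mul]
  · refine hcancel ?_
    rw [mul_assoc, hwx, mul_assoc, hy.eq, ← mul_assoc, hwx, (hmc y (hy.mul_right hy)).eq]
  -- Anticommuting with `x` implies commuting with `x²`, hence with `|x| = wx`; the sign is
  -- therefore carried by `w`.
  · have hsm : Commute s m := hmc s <| by
      change s * (x * x) = x * x * s
      rw [← mul_assoc, hs, neg_mul, mul_assoc, hs, mul_neg, neg_neg, mul_assoc]
    refine hcancel ?_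
    rw [mul_assoc, hwx, neg_mul, mul_assoc, hs, mul_neg, neg_neg, ← mul_assoc, hwx, hsm.eq]

theorem isSelfAdjoint_smul_sub_star (c : H →L[ℂ] H) :
    IsSelfAdjoint (Complex.I • (c - star c)) := by
  rw [IsSelfAdjoint, star_smul, star_sub, star_star]
  simp [← smul_neg]

theorem commute_smul_sub_star {c y : H →L[ℂ] H} (h1 : Commute y c)
    (h2 : Commute y (star c)) : Commute y (Complex.I • (c - star c)) :=
  (h1.sub_right h2).smul_right _

end SignOperator

/-! ### Injectivity from vanishing traces of powers. -/

section TracelessUnitary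

variable {Γ : Type*} [Group Γ]

/-- If all positive powers of a unitary `c` of `VN(Γ)` have trace zero, then `i(c - c*)` is
injective. -/
theorem eq_zero_of_traceless {c : EllTwo Γ →L[ℂ] EllTwo Γ}
    (hc : c ∈ (groupVN Γ).toStarSubalgebra) (hcU : star c * c = 1) (hcU' : c * star c = 1)
    (htr : ∀ k : ℕ, (c ^ (k + 1)) (delta 1) 1 = 0) {ξ : EllTwo Γ}
    (hξ : (Complex.I • (c - star c)) ξ = 0) : ξ = 0 := by
  have h1 : c ξ = star c ξ := by
    rw [smul_apply, smul_eq_zero_iff_right Complex.I_ne_zero, sub_apply, sub_eq_zero] at hξ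
    exact hξ
  have h2 : (c * c) ξ = ξ := by
    rw [mul_apply_eq_comp, h1, ← mul_apply_eq_comp, hcU', one_apply_eq_self]
  have h3 : ∀ k : ℕ, ((c * c) ^ k) ξ = ξ := fun k => by
    induction k with
    | zero => simp
    | succ k ih => rw [pow_succ, mul_apply_eq_comp, h2, ih]
  have hccU : ∀ (k : ℕ) (ζ η : EllTwo Γ),
      inner ℂ (((c * c) ^ k) ζ) (((c * c) ^ k) η) = inner ℂ ζ η := fun k ζ η => by
    have : star ((c * c) ^ k) * (c * c) ^ k = 1 := by
      have hmem : c ∈ unitary (EllTwo Γ →L[ℂ] EllTwo Γ) := ⟨hcU, hcU'⟩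
      exact (pow_mem (mul_mem hmem hmem) k).1
    rw [← ContinuousLinearMap.adjoint_inner_right, ← ContinuousLinearMap.star_eq_adjoint,
      ← mul_apply_eq_comp, this, one_apply_eq_self]
  ext h
  -- Here `c²ξ = ξ`, while the vectors `c^{2k} δ_h` are orthonormal because positive powers of `c`
  -- are traceless. All of them have inner product `ξ(h)` with `ξ`, so Bessel's inequality forces
  -- `ξ(h) = 0`.
  have horth : Orthonormal ℂ fun k : ℕ => ((c * c) ^ k) (delta h) := by
    constructor
    · intro k
      rw [← sq_eq_sq₀ (norm_nonneg _) zero_le_one, ← norm_delta h,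
        @norm_sq_eq_re_inner ℂ, @norm_sq_eq_re_inner ℂ, hccU]
    · have hlt : ∀ k l : ℕ, k < l →
          inner ℂ (((c * c) ^ k) (delta h)) (((c * c) ^ l) (delta h)) = 0 := fun k l hkl => by
        obtain ⟨d, rfl⟩ := Nat.exists_eq_add_of_lt hkl
        rw [add_assoc, pow_add, mul_apply_eq_comp, hccU, inner_delta_left, ← pow_two, ← pow_mul,
          apply_delta_apply (pow_mem hc _), mul_inv_cancel]
        exact htr (2 * d + 1)
      intro k l hkl
      rcases lt_or_gt_of_ne hkl with h | h
      · exact hlt k l h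
      · rw [← inner_conj_symm, hlt l k h, map_zero]
  have hsum := (horth.inner_products_summable ξ).tendsto_atTop_zero
  have hconst : ∀ k : ℕ, inner ℂ (((c * c) ^ k) (delta h)) ξ = ξ h := fun k => by
    rw [← inner_delta_left]
    nth_rw 1 [← h3 k]
    rw [hccU]
  simp only [hconst] at hsum
  simpa using tendsto_nhds_unique tendsto_const_nhds hsum

end TracelessUnitary

/-! ## Equivalent orthogonal projections -/

section PartialIsometry

/-- For `p = (1 + s)/2`, anticommutation gives `wpw = 1 - p`. Thus `wp` has initial projection `p`
and final projection `1 - p`, and `s ≠ -1` ensures `p ≠ 0`. -/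
theorem isOrthogonalPartialIsometry_of_anticommute {Γ : Type*} [Group Γ]
    {A : StarSubalgebra ℂ (VN Γ)} {s w : VN Γ} (hs : IsSelfAdjoint s) (hss : s * s = 1)
    (hsA : s ∈ A) (hw : IsSelfAdjoint w) (hww : w * w = 1) (hsw : s * w = -(w * s))
    (hne : s ≠ -1) :
    IsOrthogonalPartialIsometry A (w * ((1 / 2 : ℂ) • (1 + s))) := by
  have hp : star ((1 / 2 : ℂ) • (1 + s)) = (1 / 2 : ℂ) • (1 + s) := by
    rw [star_smul, star_add, star_one, hs.star_eq]
    congr 1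
    simp
  have hpp : ((1 / 2 : ℂ) • (1 + s)) * ((1 / 2 : ℂ) • (1 + s)) = (1 / 2 : ℂ) • (1 + s) := by
    rw [smul_mul_smul_comm, mul_add, add_mul, add_mul, hss, one_mul, one_mul, mul_one]
    module
  have hpA : (1 / 2 : ℂ) • (1 + s) ∈ A := StarSubalgebra.smul_mem _ (add_mem (one_mem _) hsA) _
  have hwpw : w * ((1 / 2 : ℂ) • (1 + s)) * w = 1 - (1 / 2 : ℂ) • (1 + s) := by
    rw [mul_smul_comm, smul_mul_assoc, mul_add, add_mul, mul_one, hww, mul_assoc, hsw, mul_neg,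
      ← mul_assoc, hww, one_mul]
    module
  have hpne : (1 / 2 : ℂ) • (1 + s) ≠ 0 := fun h => hne <| by
    have h1 := congrArg (fun x => (2 : ℂ) • x) h
    simp only [smul_smul, smul_zero] at h1
    norm_num at h1
    exact eq_neg_of_add_eq_zero_right h1
  generalize (1 / 2 : ℂ) • (1 + s) = p at *
  have hinit : star (w * p) * (w * p) = p := by
    rw [star_mul, hp, hw.star_eq, mul_assoc, ← mul_assoc w, hww, one_mul, hpp]
  have hfin : w * p * star (w * p) = 1 - p := by
    rw [star_mul, hp, hw.star_eq, mul_assoc, ← mul_assoc p, hpp, ← mul_assoc, hwpw]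
  have hproj : IsStarProjection p := ⟨hpp, hp⟩
  refine ⟨fun h => hpne ?_, ?_, ?_, ?_, ?_, ?_⟩
  · rw [← hinit, h, mul_zero]
  · rw [hfin]
    exact hproj.one_sub
  · rwa [hinit]
  · rw [hfin]
    exact sub_mem (one_mem _) hpA
  · rwa [hinit]
  · rw [hfin, hinit, sub_mul, one_mul, hpp, sub_self]

variable {ι : Type*} [DecidableEq ι]

/-- The endomorphism of the free group inverting the generator `i`. -/
def invertGenerator (i : ι) : FreeGroup ι →* FreeGroup ι :=
  FreeGroup.lift fun j => if j = i then (FreeGroup.of j)⁻¹ else FreeGroup.of j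

theorem invertGenerator_of (i : ι) : invertGenerator i (FreeGroup.of i) = (FreeGroup.of i)⁻¹ := by
  simp [invertGenerator]

theorem invertGenerator_invertGenerator (i : ι) (g : FreeGroup ι) :
    invertGenerator i (invertGenerator i g) = g := by
  have : (invertGenerator i).comp (invertGenerator i) = MonoidHom.id _ := by
    ext j
    by_cases hj : j = i <;> simp [invertGenerator, hj]
  exact DFunLike.congr_fun this g

/-- The involution of the free group inverting the generator `i`, as a permutation. -/
def invertPerm (i : ι) : Equiv.Perm (FreeGroup ι) :=
  ⟨invertGenerator i, invertGenerator i, invertGenerator_invertGenerator i,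
    invertGenerator_invertGenerator i⟩

theorem permOp_invertPerm_mul (i : ι) (k : ℤ) :
    permOp (invertPerm i) * leftRegular (FreeGroup.of i ^ k) =
      leftRegular (FreeGroup.of i ^ (-k)) * permOp (invertPerm i) := by
  refine clm_ext_delta fun g => ?_
  rw [mul_apply_eq_comp, mul_apply_eq_comp, leftRegular_delta, permOp_delta, permOp_delta,
    leftRegular_delta]
  congr 1
  change invertGenerator i _ = _ * invertGenerator i _
  rw [map_mul, map_zpow, invertGenerator_of, inv_zpow, zpow_neg]

theorem zpow_of_ne_one (i : ι) {m : ℤ} (hm : m ≠ 0) : FreeGroup.of i ^ m ≠ 1 := fun h => by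
  have := zpow_mul_mem_beginsWith (one_notMem_beginsWith i) hm
  rw [mul_one, h] at this
  exact one_notMem_beginsWith i this

/-- The von Neumann algebra generated by a free generator contains a symmetry of trace zero. -/
theorem exists_traceless_symmetry (i : ι) :
    ∃ s : EllTwo (FreeGroup ι) →L[ℂ] EllTwo (FreeGroup ι),
      s ∈ (groupVN (FreeGroup ι)).toStarSubalgebra ∧ IsSelfAdjoint s ∧ s * s = 1 ∧
      Commute (leftRegular (FreeGroup.of i)) s ∧ s (delta 1) 1 = 0 := by
  set a := FreeGroup.of i with ha
  have hstar : star (leftRegular a) = leftRegular a⁻¹ := star_leftRegular a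
  have hinj : ∀ ξ, (Complex.I • (leftRegular a - star (leftRegular a))) ξ = 0 → ξ = 0 := fun ξ =>
    eq_zero_of_traceless (leftRegular_mem_groupVN a)
      (by rw [hstar, ← leftRegular_mul, inv_mul_cancel, leftRegular_one])
      (by rw [hstar, ← leftRegular_mul, mul_inv_cancel, leftRegular_one]) fun k => by
        have hpow : ∀ n : ℕ, leftRegular a ^ n = leftRegular (a ^ n) := fun n => by
          induction n with
          | zero => simp [leftRegular_one]
          | succ n ih => rw [pow_succ, pow_succ, leftRegular_mul, ih]
        rw [hpow, leftRegular_delta, mul_one, delta_apply_ne]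
        have := zpow_of_ne_one i (m := (k + 1 : ℕ)) (by positivity)
        rw [zpow_natCast] at this
        exact this.symm
  -- The symmetry is the sign of `i(λ(a) - λ(a)*)`.
  obtain ⟨s, hsa, hss, hcomm, hanti⟩ := exists_sign (isSelfAdjoint_smul_sub_star _) hinj
  refine ⟨s, mem_groupVN_iff.mpr fun y hy => ?_, hsa, hss, ?_, ?_⟩
  · exact hcomm y (commute_smul_sub_star (hy a).symm (by rw [hstar]; exact (hy a⁻¹).symm))
  · refine hcomm _ (commute_smul_sub_star (Commute.refl _) ?_)
    rw [hstar]
    change _ * _ = _ * _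
    rw [← leftRegular_mul, ← leftRegular_mul, mul_inv_cancel, inv_mul_cancel]
  -- Inverting the generator exchanges `λ(a)` and `λ(a)*`, so its permutation operator anticommutes
  -- with `s`. It fixes `δ_1`, so the trace of `s` equals its own negative.
  · have h1 := permOp_invertPerm_mul i 1
    have h2 := permOp_invertPerm_mul i (-1)
    rw [neg_neg] at h2
    simp only [zpow_one, zpow_neg_one, ← ha] at h1 h2
    have h3 := hanti (permOp (invertPerm i)) <| by
      rw [mul_smul_comm, smul_mul_assoc, mul_sub, sub_mul, hstar, h1, h2, ← smul_neg, neg_sub]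
    have h4 := congrArg (fun ξ : EllTwo (FreeGroup ι) => ξ 1) (DFunLike.congr_fun h3 (delta 1))
    have h5 : invertPerm i 1 = 1 := map_one (invertGenerator i)
    have h6 : (invertPerm i).symm 1 = 1 := map_one (invertGenerator i)
    rw [mul_apply_eq_comp, neg_apply, mul_apply_eq_comp, permOp_delta, h6] at h4
    simp only [permOp_apply, h5] at h4
    rw [lp.coeFn_neg, Pi.neg_apply] at h4
    exact self_eq_neg.mp h4

/-- A traceless element of the algebra generated by the generator `i` moves vectors supported
outside of the words beginning with `i` to vectors supported on these words. -/
theorem apply_eq_zero_of_notMem_beginsWith {i : ι}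
    {s : EllTwo (FreeGroup ι) →L[ℂ] EllTwo (FreeGroup ι)}
    (hs : s ∈ (groupVN (FreeGroup ι)).toStarSubalgebra)
    (hc : Commute (leftRegular (FreeGroup.of i)) s) (htr : s (delta 1) 1 = 0)
    {ξ : EllTwo (FreeGroup ι)} (hξ : ∀ g ∈ beginsWith i, ξ g = 0) {h : FreeGroup ι}
    (hh : h ∉ beginsWith i) : s ξ h = 0 := by
  refine (hasSum_apply_delta s ξ h).unique ?_
  convert hasSum_zero with g
  by_cases hg : g ∈ beginsWith i
  · rw [hξ g hg, zero_mul]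
  · rw [apply_delta_apply hs]
    by_cases hmem : h * g⁻¹ ∈ Subgroup.zpowers (FreeGroup.of i)
    · obtain ⟨m, hm⟩ := Subgroup.mem_zpowers_iff.mp hmem
      -- For `h = a^m g` with `g` not beginning with `i`, either `m = 0` and the coefficient is the
      -- trace of `s`, or `h` begins with `i`.
      rcases eq_or_ne m 0 with rfl | hm0
      · rw [← hm, zpow_zero, htr, mul_zero]
      · refine absurd ?_ hh
        have := zpow_mul_mem_beginsWith hg hm0
        rwa [hm, inv_mul_cancel_right] at this
    · rw [coeff_eq_zero_of_commute (isMalnormalElement_of i) hs hc hmem, mul_zero]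

theorem exists_isOrthogonalPartialIsometry {i j : ι} (hij : i ≠ j) :
    ∃ v : VN (FreeGroup ι), IsOrthogonalPartialIsometry (M := VN (FreeGroup ι))
      (elementSubalgebra (FreeGroup.of i)) v := by
  obtain ⟨s, hsM, hs, hss, hsc, hstr⟩ := exists_traceless_symmetry i
  obtain ⟨t, htM, ht, htt, htc, httr⟩ := exists_traceless_symmetry j
  have hstar : star (s * t) = t * s := by rw [star_mul, hs.star_eq, ht.star_eq]
  -- Ping-pong: `t` moves vectors supported off the words beginning with `j` to those words, and `s`
  -- then moves them to words beginning with `i`. The empty word is never reached, so `(st)^{k+1}`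
  -- has trace zero.
  have hsupp : ∀ k : ℕ, ∀ h ∉ beginsWith i, ((s * t) ^ (k + 1)) (delta 1) h = 0 := by
    have hstep : ∀ ξ : EllTwo (FreeGroup ι), (∀ g ∈ beginsWith j, ξ g = 0) →
        ∀ h ∉ beginsWith i, (s * t) ξ h = 0 := fun ξ hξ h hh =>
      apply_eq_zero_of_notMem_beginsWith hsM hsc hstr (fun g hg =>
        apply_eq_zero_of_notMem_beginsWith htM htc httr hξ (disjoint_beginsWith hij hg)) hh
    intro k
    induction k with
    | zero =>
      rw [zero_add, pow_one]
      refine hstep _ fun g hg => delta_apply_ne ?_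
      rintro rfl
      exact one_notMem_beginsWith j hg
    | succ k ih =>
      rw [pow_succ', mul_apply_eq_comp]
      exact hstep _ fun g hg => ih g (disjoint_beginsWith hij.symm hg)
  have hinj : ∀ ξ, (Complex.I • (s * t - star (s * t))) ξ = 0 → ξ = 0 := fun ξ =>
    eq_zero_of_traceless (mul_mem hsM htM)
      (by rw [hstar, mul_assoc, ← mul_assoc s, hss, one_mul, htt])
      (by rw [hstar, mul_assoc, ← mul_assoc t, htt, one_mul, hss])
      fun k => hsupp k 1 (one_notMem_beginsWith i)
  obtain ⟨w, hw, hww, hcomm, hanti⟩ := exists_sign (isSelfAdjoint_smul_sub_star _) hinj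
  have hwM : w ∈ (groupVN (FreeGroup ι)).toStarSubalgebra := mem_groupVN_iff.mpr fun y hy => by
    have h1 : Commute y s := mem_groupVN_iff.mp hsM y hy
    have h2 : Commute y t := mem_groupVN_iff.mp htM y hy
    exact hcomm y (commute_smul_sub_star (h1.mul_right h2) (hstar ▸ h2.mul_right h1))
  -- Conjugation by `s` exchanges `st` and `ts`, so `s` anticommutes with `i(st - ts)` and hence
  -- with its sign.
  have hsw : s * w = -(w * s) := hanti s <| by
    rw [hstar, mul_smul_comm, smul_mul_assoc, mul_sub, sub_mul, ← mul_assoc s s, hss, one_mul,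
      mul_assoc t s s, hss, mul_one, ← smul_neg, neg_sub, mul_assoc]
  refine ⟨_, isOrthogonalPartialIsometry_of_anticommute (s := ⟨s, hsM⟩) (w := ⟨w, hwM⟩)
    (Subtype.ext hs) (Subtype.ext hss)
    (mem_elementSubalgebra_of_commute (isMalnormalElement_of i) hsc) (Subtype.ext hw)
    (Subtype.ext hww) (Subtype.ext hsw) fun h => ?_⟩
  have h1 : s = -1 := congrArg Subtype.val h
  rw [h1] at hstr
  change -(delta (1 : FreeGroup ι) 1) = 0 at hstr
  rw [delta_apply_self] at hstr
  norm_num at hstr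

end PartialIsometry

theorem corollary3p4 {ι : Type*} [Countable ι] [Nontrivial ι] (i : ι) :
    IsMasa (M := VN (FreeGroup ι)) (elementSubalgebra (FreeGroup.of i)) ∧
      IsStronglySingular (groupTrace (FreeGroup ι)) (elementSubalgebra (FreeGroup.of i)) ∧
      popaInvariant (groupTrace (FreeGroup ι)) (elementSubalgebra (FreeGroup.of i)) = 1 := by
  classical
  have ha := isMalnormalElement_of i
  obtain ⟨j, hj⟩ := exists_ne i
  exact ⟨isMasa_elementSubalgebra ha, isStronglySingular_elementSubalgebra ha,
    popaInvariant_elementSubalgebra ha (exists_isOrthogonalPartialIsometry hj.symm)⟩
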